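/- Let $M$ be a compact connected $C^\infty$ Riemannian manifold without boundary, with Riemannian distance $d$, let $f:M\to M$ be continuous, let $X\subset M$ be compact with $f(X)\subset X$, and let $T=f|_X:X\to X$ be Lipschitz. Let $\mathcal M(X,T)$ be the set of $T$-invariant Borel probability measures on $X$. Assume that $(X,T)$ satisfies the following two properties. (ASP) There are constants $\lambda,\delta,C,L>0$, fixed from now on, such that (1) for all $n\in\mathbb N$ and $x,y\in X$ with $d(T^ix,T^iy)\le\delta$ for $0\le i\le n$, one has $d(T^kx,T^ky)\le Ce^{-\lambda\min(k,n-k)}\bigl(d(x,y)+d(T^nx,T^ny)\bigr)$ for $0\le k\le n$; (2) for all $0\le\eta\le\delta$, $n\ge1$ and $x_0,\dots,x_{n-1}\in X$ with $d(Tx_i,x_{i+1})\le\eta$ for $0\le i\le n-1$ (indices mod $n$), there is a periodic point $x\in X$ whose period divides $n$ such that $d(x_i,T^ix)\le L\eta$ for $0\le i\le n-1$. (MCGBP) For every $0<\alpha\le1$ there is an integer $K\ge1$ such that for every $\alpha$-Hölder function $g:X\to\mathbb R$ there is an $\alpha$-Hölder function $v:X\to\mathbb R$ with $\frac1K\sum_{i=0}^{K-1}g\circ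 T^i-v\circ T^K+v-\min_{\nu\in\mathcal M(X,T)}\int g\,d\nu\ge0$ on $X$. For continuous $g:X\to\mathbb R$ and $\phi:X\to(0,\infty)$ let $\mathcal M_{\min}(g;\phi,X,T)$ be the set of those $\nu\in\mathcal M(X,T)$ that attain $\min_{\nu\in\mathcal M(X,T)}\int g\,d\nu/\int\phi\,d\nu$. For a periodic orbit $\mathcal O$ of $(X,T)$ let $\mu_{\mathcal O}=\frac1{\sharp\mathcal O}\sum_{x\in\mathcal O}\delta_x$, and define its gap by $D(\mathcal O)=\delta$ if $\sharp\mathcal O=1$ and $D(\mathcal O)=\min_{x\ne y\in\mathcal O}\min\{\delta,d(x,y)\}$ otherwise. For a function $g$ on $M$ write $\|g\|_0=\sup_{x\in M}|g(x)|$ and $\|Dg\|_0=\sup_{x\in M}\|D_xg\|$, where $\|D_xg\|$ is the operator norm with respect to the Riemannian metric. Let $u\in C^1(M)$, let $\psi:M\to\mathbb R$ be Lipschitz and strictly positive, and let $Z_{u,\psi,T}$ be the closure of $\bigcup_{\mu\in\mathcal M_{\min}(u|_X;\psi|_X,X,T)}\operatorname{supp}\mu$. Then there is $\hat\delta_1'>0$,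 depending only on $u$, $\psi$ and the system (and not on $\varepsilon$), such that for every $0<\varepsilon<1$ there are $\hat L_1,\hat\delta_1>0$, depending only on $\varepsilon$, $u$, $\psi$ and the system, with the following property. If a periodic orbit $\mathcal O$ of $(X,T)$ satisfies $$D(\mathcal O)>\hat L_1\sum_{x\in\mathcal O}d(x,Z_{u,\psi,T}),$$ then there is $w\in C^\infty(M)$ with $\|w\|_0<\hat\delta_1'\varepsilon$ and $\|Dw\|_0<2\varepsilon$ such that $$\mathcal M_{\min}\bigl((u+w+h)|_X;\psi|_X,X,T\bigr)=\{\mu_{\mathcal O}\}$$ for every $h\in C^1(M)$ with $\|Dh\|_0<5\varepsilon$ and $\|h\|_0<\frac{D(\mathcal O)}{\sharp\mathcal O}\hat\delta_1$. -/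

import Mathlib

open MeasureTheory Set Function
open scoped Bundle Manifold ContDiff NNReal ENNReal

namespace ErgOpt

noncomputable section

/-! ### Invariant measures and weighted ergodic optimization -/

section Measures

variable {X : Type*} [MeasurableSpace X]

/-- The set `M(X, T)` of `T`-invariant Borel probability measures. -/
def invariantMeasures (T : X → X) : Set (Measure X) :=
  {ν | IsProbabilityMeasure ν ∧ MeasurePreserving T ν ν}

/-- The minimum ergodic average `β(u; X, T) = min_ν ∫ u dν`. -/
def minAverage (T : X → X) (u : X → ℝ) : ℝ :=
  sInf ((fun ν : Measure X => ∫ x, u x ∂ν) '' invariantMeasures T)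

/-- The ratio minimum ergodic average `β(u; ψ, X, T) = min_ν ∫ u dν / ∫ ψ dν`. -/
def minRatioAverage (T : X → X) (u ψ : X → ℝ) : ℝ :=
  sInf ((fun ν : Measure X => (∫ x, u x ∂ν) / ∫ x, ψ x ∂ν) '' invariantMeasures T)

/-- The set of `(u, ψ)`-minimizing measures. -/
def minimizingMeasures (T : X → X) (u ψ : X → ℝ) : Set (Measure X) :=
  {ν | ν ∈ invariantMeasures T ∧ (∫ x, u x ∂ν) / (∫ x, ψ x ∂ν) = minRatioAverage T u ψ}

/-- The set `Z_{u,ψ}`: the closure of the union of the supports of all minimizing measures. -/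
def minimizingSet [TopologicalSpace X] (T : X → X) (u ψ : X → ℝ) : Set X :=
  closure (⋃ ν ∈ minimizingMeasures T u ψ, ν.support)

/-- The uniform probability measure on a finite set of points. -/
def orbitMeasure (O : Finset X) : Measure X :=
  (O.card : ℝ≥0∞)⁻¹ • ∑ x ∈ O, Measure.dirac x

end Measures

/-! ### Shadowing and the Mañé–Conze–Guivarc'h–Bousch property -/

section Systems

variable {X : Type*} [MetricSpace X]

/-- `O` is (the set of points of) a periodic orbit of `T`. -/
def IsPeriodicOrbit (T : X → X) (O : Finset X) : Prop :=
  ∃ p ∈ periodicPts T, (O : Set X) = range fun i : ℕ => T^[i] p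

/-- The points `x 0, …, x (n - 1)` form a periodic `η`-pseudo-orbit (indices mod `n`). -/
def IsPeriodicPseudoOrbit (T : X → X) (η : ℝ) (n : ℕ) (x : ℕ → X) : Prop :=
  ∀ i < n, dist (T (x i)) (x ((i + 1) % n)) ≤ η

/-- The Anosov shadowing property, with its constants `lam, δ, C, L`. -/
structure IsASP (T : X → X) (lam δ C L : ℝ) : Prop where
  lam_pos : 0 < lam
  δ_pos : 0 < δ
  C_pos : 0 < C
  L_pos : 0 < L
  contract : ∀ n : ℕ, 1 ≤ n → ∀ x y : X, (∀ i ≤ n, dist (T^[i] x) (T^[i] y) ≤ δ) →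
    ∀ k ≤ n, dist (T^[k] x) (T^[k] y) ≤
      C * Real.exp (-lam * (min k (n - k) : ℕ)) * (dist x y + dist (T^[n] x) (T^[n] y))
  shadow : ∀ η : ℝ, 0 ≤ η → η ≤ δ → ∀ n : ℕ, 1 ≤ n → ∀ x : ℕ → X,
    IsPeriodicPseudoOrbit T η n x →
      ∃ p ∈ periodicPts T, minimalPeriod T p ∣ n ∧ ∀ i < n, dist (x i) (T^[i] p) ≤ L * η

/-- `u` is `α`-Hölder continuous. -/
def IsHolder (α : ℝ≥0) (u : X → ℝ) : Prop := ∃ C : ℝ≥0, HolderWith C α u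

/-- The Mañé–Conze–Guivarc'h–Bousch property. -/
def IsMCGBP [MeasurableSpace X] (T : X → X) : Prop :=
  ∀ α : ℝ≥0, 0 < α → α ≤ 1 → ∃ K : ℕ, 1 ≤ K ∧ ∀ u : X → ℝ, IsHolder α u →
    ∃ v : X → ℝ, IsHolder α v ∧
      ∀ x, 0 ≤ birkhoffAverage ℝ T u K x - v (T^[K] x) + v x - minAverage T u

/-- The `α`-deviation `d_{α,Z}(O) = ∑_{x ∈ O} d(x, Z)^α`. -/
def deviation (α : ℝ) (Z : Set X) (O : Finset X) : ℝ :=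
  ∑ x ∈ O, Metric.infDist x Z ^ α

/-- The distance truncated at `δ`. -/
def truncDist (δ : ℝ) (x y : X) : ℝ := if δ ≤ dist x y then δ else dist x y

/-- The gap `D(O)` of a periodic orbit: `δ` for a fixed point, otherwise the smallest truncated
distance between two distinct points of `O`. -/
def gap (δ : ℝ) (O : Finset X) : ℝ :=
  if O.card = 1 then δ else sInf {r | ∃ x ∈ O, ∃ y ∈ O, x ≠ y ∧ r = truncDist δ x y}

end Systems

/-! ### Norms of functions on a Riemannian manifold -/

/-- The sup norm `‖g‖₀`, with values in `[0, ∞]`. -/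
def supNorm {M : Type*} (g : M → ℝ) : ℝ≥0∞ := ⨆ x, ‖g x‖ₑ

/-- The sup norm `‖D g‖₀` of the derivative, with values in `[0, ∞]`; the differential at `x` is
measured in the operator norm given by the Riemannian metric on the tangent space at `x`. -/
def derivSupNorm {n : ℕ} {M : Type*} [TopologicalSpace M]
    [ChartedSpace (EuclideanSpace ℝ (Fin n)) M]
    [Bundle.RiemannianBundle (fun x : M => TangentSpace (𝓡 n) x)] (g : M → ℝ) : ℝ≥0∞ :=
  ⨆ x : M, ‖mvfderiv (𝓡 n) g x‖ₑ

end

end ErgOpt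

namespace ErgOpt

/-! ### Calculus on Riemannian manifolds: derivative bounds, Lipschitz constants, chart distances.
-/

section Riemannian

open Manifold Topology Filter

variable {E : Type*} [NormedAddCommGroup E] [NormedSpace ℝ E]
  {H : Type*} [TopologicalSpace H] {I : ModelWithCorners ℝ E H}
  {M : Type*} [MetricSpace M] [ChartedSpace H M]
  {F : Type*} [NormedAddCommGroup F] [NormedSpace ℝ F]

/-! Let `β` be the minimal ratio and `D` the gap of `O`. MCGBP with exponent 1 yields a nonnegative
Lipschitz `g` that has the same integrals as `u - βψ` and vanishes on `Z` (`exists_normalization`).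
Hence `∑ g` over `O` is at most a constant times the deviation, and the gap hypothesis makes it at
most `t * D` with `t` as small as needed.

The perturbation `w` vanishes on `O` and is a fixed multiple of `εD` away from it
(`exists_smooth_penalty`). If `a` is the ratio of `u + w + h` to `ψ` along `O`, then `a - β` is of
order `tD/♯O`. This gives a Lipschitz `F` with the integrals of `u + w + h - aψ` and zero sum over
`O`; it is at least `-η` with `η` of order `tD/♯O`, nonnegative at distance `θD` from `O`, and of
order `εD` at distance `ρD`.

While an orbit stays within `ρD` of `O` it follows a single orbit in `O`, because `O` is
`D`-separated. The contraction in ASP makes the total distance between the two comparable to the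
distance at the ends, so such a segment has Birkhoff sum at least `-E` whatever its length. A visit
to the set `B` of points farther than that pays `E + κ`. So Birkhoff sums of `F` are at least `-E`
plus `κ` times the number of visits to `B` (`IsPenalized.neg_add_le_birkhoffSum`), and integration
gives `∫ F dν ≥ κ ν(B)`. If `∫ F dν ≤ 0`, then `ν(B) = 0`: almost every orbit stays near `O`
forever, and contraction with invariance puts `ν` on `O` (`measure_compl_eq_zero_of_near`).

Two scales are used because `θ` must be small relative to the payment at scale `ρ`: `ρ` fixes that
payment, the payment fixes `θ`, and only then is `t` chosen. -/

theorem contDiffAt_comp_extChartAt_symm {k : ℕ∞} [I.Boundaryless] [IsManifold I k M] {g : M → F}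
    (hg : ContMDiff I 𝓘(ℝ, F) k g) (x : M) {z : E} (hz : z ∈ (extChartAt I x).target) :
    ContDiffAt ℝ k (g ∘ (extChartAt I x).symm) z := by
  rw [← contMDiffAt_iff_contDiffAt]
  exact hg.contMDiffAt.comp z ((contMDiffOn_extChartAt_symm x).contMDiffAt
    ((isOpen_extChartAt_target x).mem_nhds hz))

theorem mvfderiv_apply_eq_extChartAt [I.Boundaryless] [IsManifold I 1 M] {g : M → F}
    (hg : ContMDiff I 𝓘(ℝ, F) 1 g) {x y : M} (hy : y ∈ (chartAt H x).source)
    (v : TangentSpace I y) :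
    mvfderiv I g y v = fderiv ℝ (g ∘ (extChartAt I x).symm) (extChartAt I x y)
      (mvfderiv I (extChartAt I x) y v) := by
  have hy' : y ∈ (extChartAt I x).source := by simpa using hy
  have hev : g =ᶠ[𝓝 y] (g ∘ (extChartAt I x).symm) ∘ extChartAt I x := by
    filter_upwards [(isOpen_extChartAt_source (I := I) x).mem_nhds hy'] with z hz
    simp only [comp_apply]
    rw [(extChartAt I x).left_inv hz]
  have hd := (contDiffAt_comp_extChartAt_symm (k := 1) hg x
    ((extChartAt I x).map_source hy')).differentiableAt one_ne_zero
  have h1 := mfderiv_comp y hd.mdifferentiableAt (mdifferentiableAt_extChartAt hy)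
  rw [← hev.mfderiv_eq] at h1
  have h2 := congr($h1 v)
  rw [mfderiv_eq_fderiv] at h2
  exact h2

variable [Bundle.RiemannianBundle (fun x : M => TangentSpace I x)]

/-- A `C^1` map along a `C^1` path moves at most by the derivative bound times the length. -/
theorem edist_le_mul_pathELength {g : M → F} (hg : ContMDiff I 𝓘(ℝ, F) 1 g) {C : ℝ≥0}
    (h : ∀ x, ‖mvfderiv I g x‖ₑ ≤ C) {γ : ℝ → M}
    (hγ : ContMDiffOn 𝓘(ℝ, ℝ) I 1 γ (Icc 0 1)) :
    edist (g (γ 0)) (g (γ 1)) ≤ C * pathELength I γ 0 1 := by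
  have hc : ContDiffOn ℝ 1 (g ∘ γ) (Icc 0 1) :=
    contMDiffOn_iff_contDiffOn.1 (hg.comp_contMDiffOn hγ)
  calc
    edist (g (γ 0)) (g (γ 1)) = ‖(g ∘ γ) 1 - (g ∘ γ) 0‖ₑ := by
      rw [edist_comm, edist_eq_enorm_sub]; rfl
    _ ≤ ∫⁻ t in Icc 0 1, ‖derivWithin (g ∘ γ) (Icc 0 1) t‖ₑ :=
      enorm_sub_le_lintegral_derivWithin_Icc_of_contDiffOn_Icc hc zero_le_one
    _ ≤ ∫⁻ t in Icc 0 1, C * ‖mfderivWithin 𝓘(ℝ, ℝ) I γ (Icc 0 1) t 1‖ₑ := by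
      apply setLIntegral_mono' measurableSet_Icc (fun t ht ↦ ?_)
      have h1 : mfderivWithin 𝓘(ℝ, ℝ) 𝓘(ℝ, F) (g ∘ γ) (Icc 0 1) t =
          (mfderiv I 𝓘(ℝ, F) g (γ t)) ∘L (mfderivWithin 𝓘(ℝ, ℝ) I γ (Icc 0 1) t) := by
        apply mfderiv_comp_mfderivWithin
        · exact hg.mdifferentiable one_ne_zero _
        · exact hγ.mdifferentiableOn one_ne_zero t ht
        · rw [uniqueMDiffWithinAt_iff_uniqueDiffWithinAt]
          exact uniqueDiffOn_Icc zero_lt_one _ ht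
      have h2 : derivWithin (g ∘ γ) (Icc 0 1) t =
          mvfderiv I g (γ t) (mfderivWithin 𝓘(ℝ, ℝ) I γ (Icc 0 1) t 1) := by
        rw [← fderivWithin_derivWithin, ← mfderivWithin_eq_fderivWithin, h1]
        rfl
      rw [h2]
      refine (ContinuousLinearMap.le_opENorm _ _).trans ?_
      gcongr
      exact h _
    _ = C * pathELength I γ 0 1 := by
      rw [lintegral_const_mul' _ _ ENNReal.coe_ne_top, pathELength_eq_lintegral_mfderivWithin_Icc]

/-- On a Riemannian manifold, a `C^1` map whose derivative is bounded by `C` is `C`-Lipschitz. -/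
theorem lipschitzWith_of_enorm_mvfderiv_le [IsRiemannianManifold I M] {g : M → F}
    (hg : ContMDiff I 𝓘(ℝ, F) 1 g) {C : ℝ≥0} (h : ∀ x, ‖mvfderiv I g x‖ₑ ≤ C) :
    LipschitzWith C g := by
  intro x y
  refine ENNReal.le_of_forall_pos_le_add fun r hr _ ↦ ?_
  -- The slack is divided by `C + 1` rather than `C`, so that `C = 0` is covered.
  have hr' : (0 : ℝ≥0) < r / (C + 1) := by positivity
  have hlt : riemannianEDist I x y < edist x y + (r / (C + 1) : ℝ≥0) := by
    rw [← IsRiemannianManifold.out (I := I) x y]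
    exact ENNReal.lt_add_right (edist_ne_top x y) (by exact_mod_cast hr'.ne')
  obtain ⟨γ, h0, h1, hγ, hlen⟩ := exists_lt_of_riemannianEDist_lt hlt
  have h2 := edist_le_mul_pathELength hg h hγ
  rw [h0, h1] at h2
  refine h2.trans ((mul_le_mul_right hlen.le _).trans ?_)
  rw [mul_add]
  gcongr
  rw [← ENNReal.coe_mul]
  norm_cast
  rw [← mul_div_assoc, div_le_iff₀ (by positivity), mul_comm]
  gcongr
  simp

section ChartBounds

variable [IsManifold I 1 M] [IsContinuousRiemannianBundle E (fun x : M => TangentSpace I x)]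

attribute [local instance] normedAddCommGroupTangentSpaceVectorSpace
attribute [local instance] normedSpaceTangentSpaceVectorSpace

variable (I) in
theorem eventually_norm_mfderiv_extChartAt_apply_le (x : M) :
    ∃ C > (0 : ℝ), ∀ᶠ y in 𝓝 x, ∀ v : TangentSpace I y,
      ‖mvfderiv I (extChartAt I x) y v‖ ≤ C * ‖v‖ := by
  obtain ⟨C, hC, h⟩ := eventually_norm_mfderiv_extChartAt_lt I x
  refine ⟨C, hC, h.mono fun y hy v ↦ ?_⟩
  have := (mfderiv I 𝓘(ℝ, E) (extChartAt I x) y).le_opNorm v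
  exact this.trans (mul_le_mul_of_nonneg_right hy.le (norm_nonneg v))

variable (I) in
theorem eventually_enorm_mfderivWithin_symm_extChartAt_apply_le (x : M) :
    ∃ C > (0 : ℝ≥0), ∀ᶠ y in 𝓝[range I] (extChartAt I x x), ∀ v : E,
      ‖mfderivWithin 𝓘(ℝ, E) I (extChartAt I x).symm (range I) y v‖ₑ ≤ C * ‖v‖ₑ := by
  obtain ⟨C, hC, h⟩ := eventually_enorm_mfderivWithin_symm_extChartAt_lt I x
  refine ⟨C, hC, h.mono fun y hy v ↦ ?_⟩
  have := (mfderivWithin 𝓘(ℝ, E) I (extChartAt I x).symm (range I) y).le_opENorm v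
  exact this.trans (mul_le_mul_left hy.le _)

variable (I) in
/-- The Riemannian distance is locally controlled by the distance in a chart. -/
theorem eventually_edist_le_extChartAt [IsRiemannianManifold I M] (x : M) :
    ∃ C > (0 : ℝ≥0), ∀ᶠ p : M × M in 𝓝 (x, x),
      edist p.1 p.2 ≤ C * edist (extChartAt I x p.1) (extChartAt I x p.2) := by
  obtain ⟨C, C_pos, hC⟩ := eventually_enorm_mfderivWithin_symm_extChartAt_apply_le I x
  refine ⟨C, C_pos, ?_⟩
  obtain ⟨r, r_pos, hr⟩ : ∃ r > 0,
      Metric.ball (extChartAt I x x) r ∩ range I ⊆ (extChartAt I x).target ∩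
        {y | ∀ v : E,
          ‖mfderivWithin 𝓘(ℝ, E) I (extChartAt I x).symm (range I) y v‖ₑ ≤ C * ‖v‖ₑ} :=
    Metric.mem_nhdsWithin_iff.1 (inter_mem (extChartAt_target_mem_nhdsWithin x) hC)
  have A : (extChartAt I x) ⁻¹' (Metric.ball (extChartAt I x x) r ∩ range I) ∈ 𝓝 x := by
    apply extChartAt_preimage_mem_nhds_of_mem_nhdsWithin (by simp)
    rw [inter_comm]
    exact inter_mem_nhdsWithin _ (Metric.ball_mem_nhds _ r_pos)
  have B := inter_mem A (chart_source_mem_nhds H x)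
  rw [nhds_prod_eq]
  filter_upwards [prod_mem_prod B B] with ⟨y, z⟩ ⟨⟨hy, h'y⟩, ⟨hz, h'z⟩⟩
  -- The competing path is the straight segment in the chart; it stays in the region where the
  -- inverse chart has bounded derivative, since a ball intersected with `range I` is convex.
  let η := ContinuousAffineMap.lineMap (R := ℝ) (extChartAt I x y) (extChartAt I x z)
  set γ := (extChartAt I x).symm ∘ η with hγ_def
  have hη : Icc 0 1 ⊆ ⇑η ⁻¹' ((extChartAt I x).target ∩
        {y | ∀ v : E,
          ‖mfderivWithin 𝓘(ℝ, E) I (extChartAt I x).symm (range I) y v‖ₑ ≤ C * ‖v‖ₑ}) := by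
    simp only [← image_subset_iff, ContinuousAffineMap.coe_lineMap_eq,
     ← segment_eq_image_lineMap, η]
    apply Subset.trans _ hr
    exact ((convex_ball _ _).inter I.convex_range).segment_subset hy hz
  simp only [preimage_inter, subset_inter_iff] at hη
  have η_smooth : ContMDiffOn 𝓘(ℝ, ℝ) 𝓘(ℝ, E) 1 η (Icc 0 1) := by
    apply ContMDiff.contMDiffOn
    rw [contMDiff_iff_contDiff]
    exact ContinuousAffineMap.contDiff _
  have : riemannianEDist I y z ≤ pathELength I γ 0 1 := by
    apply riemannianEDist_le_pathELength _ _ _ zero_le_one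
    · exact (contMDiffOn_extChartAt_symm x).comp η_smooth hη.1
    · simp [γ, η, ContinuousAffineMap.coe_lineMap_eq, h'y]
    · simp [γ, η, ContinuousAffineMap.coe_lineMap_eq, h'z]
  rw [IsRiemannianManifold.out (I := I)]
  apply this.trans
  rw [← lintegral_fderiv_lineMap_eq_edist, pathELength_eq_lintegral_mfderivWithin_Icc,
    ← lintegral_const_mul' _ _ ENNReal.coe_ne_top]
  apply setLIntegral_mono' measurableSet_Icc (fun t ht ↦ ?_)
  have h1 : mfderivWithin 𝓘(ℝ, ℝ) I γ (Icc 0 1) t =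
      (mfderivWithin 𝓘(ℝ, E) I (extChartAt I x).symm (range I) (η t)) ∘L
        (mfderivWithin 𝓘(ℝ, ℝ) 𝓘(ℝ, E) η (Icc 0 1) t) := by
    apply mfderivWithin_comp
    · exact mdifferentiableWithinAt_extChartAt_symm (hη.1 ht)
    · exact η_smooth.mdifferentiableOn one_ne_zero t ht
    · exact hη.1.trans (preimage_mono (extChartAt_target_subset_range x))
    · rw [uniqueMDiffWithinAt_iff_uniqueDiffWithinAt]
      exact uniqueDiffOn_Icc zero_lt_one t ht
  have h2 : mfderivWithin 𝓘(ℝ, ℝ) I γ (Icc 0 1) t 1 =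
      (mfderivWithin 𝓘(ℝ, E) I (extChartAt I x).symm (range I) (η t))
        (mfderivWithin 𝓘(ℝ, ℝ) 𝓘(ℝ, E) η (Icc 0 1) t 1) := congr($h1 1)
  rw [h2]
  refine (hη.2 ht _).trans (le_of_eq ?_)
  simp only [mfderivWithin_eq_fderivWithin]
  rfl

end ChartBounds

variable [IsManifold I 1 M] [IsContinuousRiemannianBundle E (fun x : M => TangentSpace I x)]
  [I.Boundaryless]

/-- The tangent norm varies with the base point, so the bound is read in a chart: there the
derivative is continuous, and the derivative of the chart is locally bounded because the metric is
continuous. -/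
theorem eventually_enorm_mvfderiv_le {g : M → F} (hg : ContMDiff I 𝓘(ℝ, F) 1 g) (x : M) :
    ∃ C : ℝ≥0, ∀ᶠ y in 𝓝 x, ‖mvfderiv I g y‖ₑ ≤ C := by
  obtain ⟨C, hC, h⟩ := eventually_norm_mfderiv_extChartAt_apply_le I x
  have hd := contDiffAt_comp_extChartAt_symm (k := 1) hg x (mem_extChartAt_target x)
  have hc : ContinuousAt (fun y ↦ ‖fderiv ℝ (g ∘ (extChartAt I x).symm) (extChartAt I x y)‖) x :=
    ContinuousAt.norm (((hd.fderiv_right (m := 0) (by simp)).continuousAt).comp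
      (f := extChartAt I x) (continuousAt_extChartAt x))
  have hb := hc.eventually_lt continuousAt_const (lt_add_one _)
  refine ⟨Real.toNNReal ((‖fderiv ℝ (g ∘ (extChartAt I x).symm) (extChartAt I x x)‖ + 1) * C), ?_⟩
  filter_upwards [h, hb, chart_source_mem_nhds H x] with y hy hby hys
  rw [← ofReal_norm]
  refine ENNReal.ofReal_le_ofReal (ContinuousLinearMap.opNorm_le_bound _ (by positivity) fun v ↦ ?_)
  rw [mvfderiv_apply_eq_extChartAt hg hys, mul_assoc]
  exact (ContinuousLinearMap.le_opNorm _ _).trans (mul_le_mul hby.le (hy v) (norm_nonneg _)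
    (by positivity))

/-- The derivative of a `C^1` map on a compact Riemannian manifold is bounded. -/
theorem exists_enorm_mvfderiv_le [CompactSpace M] {g : M → F} (hg : ContMDiff I 𝓘(ℝ, F) 1 g) :
    ∃ C : ℝ≥0, ∀ y, ‖mvfderiv I g y‖ₑ ≤ C := by
  choose C hC using eventually_enorm_mvfderiv_le hg
  obtain ⟨t, ht⟩ := CompactSpace.elim_nhds_subcover _ hC
  refine ⟨t.sup C, fun y ↦ ?_⟩
  have hy : y ∈ ⋃ x ∈ t, {y | ‖mvfderiv I g y‖ₑ ≤ C x} := by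
    have := mem_univ y
    rwa [← top_eq_univ, ← ht] at this
  obtain ⟨x, hx, hxy⟩ := mem_iUnion₂.1 hy
  exact le_trans hxy (by exact_mod_cast Finset.le_sup hx)

end Riemannian

/-! ### Smooth penalty functions vanishing on a separated finite set. -/

section Penalty

open Manifold Topology Filter

variable {E : Type*} [NormedAddCommGroup E] [NormedSpace ℝ E]
  {H : Type*} [TopologicalSpace H] {I : ModelWithCorners ℝ E H}
  {M : Type*} [MetricSpace M] [ChartedSpace H M]
  {F : Type*} [NormedAddCommGroup F] [NormedSpace ℝ F]

/-- A map with injective strict derivative is locally expanding up to a constant. -/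
theorem eventually_le_dist_of_injective_fderiv [FiniteDimensional ℝ E] {g : E → F} {A : E →L[ℝ] F}
    {a : E} (hg : HasStrictFDerivAt g A a) (hA : Injective A) :
    ∃ c > (0 : ℝ), ∀ᶠ p : E × E in 𝓝 (a, a), c * dist p.1 p.2 ≤ dist (g p.1) (g p.2) := by
  obtain ⟨K, hK, hAK⟩ := (A : E →ₗ[ℝ] F).exists_antilipschitzWith (LinearMap.ker_eq_bot.2 hA)
  have hK0 : (0 : ℝ) < K := by exact_mod_cast hK
  -- `A` expands by at least `1/K`; half of this absorbs the linearization error.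
  refine ⟨(2 * K : ℝ)⁻¹, by positivity, ?_⟩
  filter_upwards [hg.isLittleO.bound (show (0 : ℝ) < (2 * K : ℝ)⁻¹ by positivity)] with p hp
  have h1 : ‖p.1 - p.2‖ ≤ K * ‖A (p.1 - p.2)‖ := by
    simpa [dist_eq_norm] using hAK.le_mul_dist (p.1 - p.2) 0
  have h2 : ‖A (p.1 - p.2)‖ ≤ ‖g p.1 - g p.2‖ + ‖g p.1 - g p.2 - A (p.1 - p.2)‖ := by
    have := norm_sub_le (g p.1 - g p.2) (g p.1 - g p.2 - A (p.1 - p.2))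
    simpa using this
  rw [dist_eq_norm, dist_eq_norm]
  have h3 : (K : ℝ)⁻¹ * ‖p.1 - p.2‖ ≤ ‖A (p.1 - p.2)‖ := by
    rw [inv_mul_le_iff₀ hK0]; exact h1
  have h4 : (K : ℝ)⁻¹ = (2 * K : ℝ)⁻¹ + (2 * K : ℝ)⁻¹ := by field_simp; norm_num
  rw [h4, add_mul] at h3
  linarith

theorem injective_fderiv_comp_extChartAt_symm [I.Boundaryless] [IsManifold I 1 M] {g : M → F}
    (hg : ContMDiff I 𝓘(ℝ, F) 1 g) (x : M) (hx : Injective (mfderiv I 𝓘(ℝ, F) g x)) :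
    Injective (fderiv ℝ (g ∘ (extChartAt I x).symm) (extChartAt I x x)) := by
  rw [injective_iff_map_eq_zero]
  intro w hw
  obtain ⟨B, hB⟩ := isInvertible_mfderiv_extChartAt (mem_extChartAt_source (I := I) x)
  have h1 : mvfderiv I (extChartAt I x) x (B.symm w) = w := by
    change mfderiv I 𝓘(ℝ, E) (extChartAt I x) x (B.symm w) = w
    rw [← hB]; exact B.apply_symm_apply w
  have h2 := mvfderiv_apply_eq_extChartAt hg (mem_chart_source H x) (B.symm w)
  rw [h1, hw] at h2
  have h3 : B.symm w = 0 := hx (h2.trans (map_zero (mvfderiv I g x)).symm)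
  rw [← h1, h3, map_zero]

variable [Bundle.RiemannianBundle (fun x : M => TangentSpace I x)]
variable [IsManifold I 1 M] [IsContinuousRiemannianBundle E (fun x : M => TangentSpace I x)]
  [I.Boundaryless]

theorem eventually_le_dist_of_injective_mfderiv [IsRiemannianManifold I M] [FiniteDimensional ℝ E]
    {g : M → F} (hg : ContMDiff I 𝓘(ℝ, F) 1 g) (x : M)
    (hx : Injective (mfderiv I 𝓘(ℝ, F) g x)) :
    ∃ c > (0 : ℝ), ∀ᶠ p : M × M in 𝓝 (x, x), c * dist p.1 p.2 ≤ dist (g p.1) (g p.2) := by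
  obtain ⟨C, hC, h⟩ := eventually_edist_le_extChartAt I x
  have hd := (contDiffAt_comp_extChartAt_symm (k := 1) hg x
    (mem_extChartAt_target x)).hasStrictFDerivAt one_ne_zero
  obtain ⟨c, hc, h'⟩ := eventually_le_dist_of_injective_fderiv hd
    (injective_fderiv_comp_extChartAt_symm hg x hx)
  have hcont : Tendsto (fun p : M × M ↦ (extChartAt I x p.1, extChartAt I x p.2)) (𝓝 (x, x))
      (𝓝 (extChartAt I x x, extChartAt I x x)) := by
    rw [nhds_prod_eq, nhds_prod_eq]
    exact Tendsto.prodMap (continuousAt_extChartAt x) (continuousAt_extChartAt x)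
  have hs : ∀ᶠ p : M × M in 𝓝 (x, x), p.1 ∈ (extChartAt I x).source ∧
      p.2 ∈ (extChartAt I x).source := by
    rw [nhds_prod_eq]
    exact prod_mem_prod (extChartAt_source_mem_nhds x) (extChartAt_source_mem_nhds x)
  have hC0 : (0 : ℝ) < C := by exact_mod_cast hC
  refine ⟨c / C, by positivity, ?_⟩
  filter_upwards [h, hcont.eventually h', hs] with p h1 h2 h3
  simp only [comp_apply, (extChartAt I x).left_inv h3.1, (extChartAt I x).left_inv h3.2] at h2
  have h4 : dist p.1 p.2 ≤ C * dist (extChartAt I x p.1) (extChartAt I x p.2) := by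
    rw [edist_nndist, edist_nndist] at h1
    exact_mod_cast h1
  refine le_trans ?_ h2
  rw [div_mul_eq_mul_div, div_le_iff₀ hC0, mul_assoc]
  exact mul_le_mul_of_nonneg_left (by linarith) hc.le

/-- Compactness of `M × M`: near the diagonal the lower bound comes from the injective derivative,
off the diagonal from injectivity of `g` and continuity. -/
theorem exists_le_dist_of_injective_mfderiv [IsRiemannianManifold I M] [FiniteDimensional ℝ E]
    [CompactSpace M] {g : M → F} (hg : ContMDiff I 𝓘(ℝ, F) 1 g) (hinj : Injective g)
    (hx : ∀ x, Injective (mfderiv I 𝓘(ℝ, F) g x)) :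
    ∃ c > (0 : ℝ), ∀ x y, c * dist x y ≤ dist (g x) (g y) := by
  have key : ∀ q : M × M, ∃ c > (0 : ℝ), ∀ᶠ p in 𝓝 q, c * dist p.1 p.2 ≤ dist (g p.1) (g p.2) := by
    rintro ⟨x, y⟩
    rcases eq_or_ne x y with rfl | hxy
    · exact eventually_le_dist_of_injective_mfderiv hg x (hx x)
    · have h1 : 0 < dist x y := dist_pos.2 hxy
      have h2 : 0 < dist (g x) (g y) := dist_pos.2 (hinj.ne hxy)
      refine ⟨dist (g x) (g y) / (2 * dist x y), by positivity, ?_⟩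
      have hc : Continuous g := hg.continuous
      have : ∀ᶠ p in 𝓝 (x, y), dist (g x) (g y) / (2 * dist x y) * dist p.1 p.2 <
          dist (g p.1) (g p.2) := by
        refine ContinuousAt.eventually_lt (by fun_prop) (by fun_prop) ?_
        simp only
        rw [div_mul_eq_mul_div, div_lt_iff₀ (by positivity)]
        nlinarith [mul_pos h1 h2]
      exact this.mono fun p hp ↦ hp.le
  choose c hc h using key
  obtain ⟨t, ht⟩ := CompactSpace.elim_nhds_subcover _ h
  by_cases hne : t.Nonempty
  · refine ⟨t.inf' hne c, (Finset.lt_inf'_iff hne).2 fun q _ ↦ hc q, fun x y ↦ ?_⟩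
    have hy : (x, y) ∈ ⋃ q ∈ t, {p : M × M | c q * dist p.1 p.2 ≤ dist (g p.1) (g p.2)} := by
      have := mem_univ (x, y)
      rwa [← top_eq_univ, ← ht] at this
    obtain ⟨q, hq, hxy⟩ := mem_iUnion₂.1 hy
    exact le_trans (mul_le_mul_of_nonneg_right (Finset.inf'_le _ hq) dist_nonneg) hxy
  · refine ⟨1, one_pos, fun x y ↦ ?_⟩
    have := mem_univ (x, y)
    rw [← top_eq_univ, ← ht] at this
    simp [Finset.not_nonempty_iff_eq_empty.1 hne] at this

/-- Uniformly scaled smooth bump functions on a compact Riemannian manifold. -/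
theorem exists_scaled_bump [IsRiemannianManifold I M] [FiniteDimensional ℝ E]
    [IsManifold I ∞ M] [CompactSpace M] {θ : ℝ} (hθ : 0 < θ) :
    ∃ B > (0 : ℝ), ∀ (p : M) (D : ℝ), 0 < D → ∃ b : M → ℝ, ContMDiff I 𝓘(ℝ, ℝ) ∞ b ∧
      b p = 1 ∧ (∀ x, 0 ≤ b x ∧ b x ≤ 1) ∧ (∀ x, θ * D ≤ dist x p → b x = 0) ∧
      ∀ x, ‖mvfderiv I b x‖ ≤ B / D := by
  -- The bumps are pulled back from a Euclidean space by a bi-Lipschitz embedding, so their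
  -- constants do not depend on the centre.
  obtain ⟨N, e, he, hemb, hinj⟩ := exists_embedding_euclidean_of_compact (I := I) (M := M)
  have he1 : ContMDiff I 𝓘(ℝ, EuclideanSpace ℝ (Fin N)) 1 e := he.of_le (by simp)
  obtain ⟨c, hc, hce⟩ := exists_le_dist_of_injective_mfderiv he1 hemb.injective hinj
  obtain ⟨Ce, hCe⟩ := exists_enorm_mvfderiv_le he1
  let χ : ContDiffBump (0 : EuclideanSpace ℝ (Fin N)) := ⟨1 / 2, 1, by norm_num, by norm_num⟩
  have hχ : ContDiff ℝ ∞ χ := χ.contDiff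
  obtain ⟨B₀, hB₀⟩ := (hχ.continuous_fderiv (by simp)).bounded_above_of_compact_support
    (χ.hasCompactSupport.fderiv (𝕜 := ℝ))
  have hB₀0 : 0 ≤ B₀ := (norm_nonneg _).trans (hB₀ 0)
  refine ⟨B₀ * Ce / (c * θ) + 1, by positivity, fun p D hD ↦ ?_⟩
  -- With the lower Lipschitz constant `c` of `e`, distance `θ * D` from `p` becomes Euclidean norm
  -- at least 1, outside the support of `χ`.
  set s : ℝ := (c * θ * D)⁻¹ with hs
  have hs0 : 0 < s := by positivity
  have hG : ContDiff ℝ ∞ (fun z : EuclideanSpace ℝ (Fin N) ↦ χ (s • (z - e p))) :=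
    hχ.comp ((contDiff_id.sub contDiff_const).const_smul s)
  refine ⟨fun x ↦ χ (s • (e x - e p)), hG.contMDiff.comp he, ?_, fun x ↦ ⟨χ.nonneg, χ.le_one⟩,
    fun x hx ↦ ?_, fun x ↦ ?_⟩
  · simpa using χ.one_of_mem_closedBall (x := 0) (by simp [χ])
  · refine χ.zero_of_le_dist ?_
    rw [dist_zero_right, norm_smul, Real.norm_of_nonneg hs0.le, ← dist_eq_norm]
    change 1 ≤ s * dist (e x) (e p)
    rw [hs, ← div_eq_inv_mul, le_div_iff₀ (by positivity), one_mul, mul_assoc]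
    exact (mul_le_mul_of_nonneg_left hx hc.le).trans (hce x p)
  · have hGd : ∀ z, ‖fderiv ℝ (fun z : EuclideanSpace ℝ (Fin N) ↦ χ (s • (z - e p))) z‖
        ≤ B₀ * s := by
      intro z
      have h1 : HasFDerivAt (fun z : EuclideanSpace ℝ (Fin N) ↦ s • (z - e p))
          (s • ContinuousLinearMap.id ℝ _) z := ((hasFDerivAt_id z).sub_const (e p)).const_smul s
      have h2 := ((hχ.differentiable (by simp)) (s • (z - e p))).hasFDerivAt.comp z h1
      have h3 : fderiv ℝ (fun z : EuclideanSpace ℝ (Fin N) ↦ χ (s • (z - e p))) z = _ := h2.fderiv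
      rw [h3, ContinuousLinearMap.comp_smul, ContinuousLinearMap.comp_id, norm_smul,
        Real.norm_of_nonneg hs0.le, mul_comm]
      exact mul_le_mul_of_nonneg_right (hB₀ _) hs0.le
    have hb : (B₀ * Ce / (c * θ) + 1) / D = B₀ * s * Ce + 1 / D := by
      rw [hs]; field_simp
    rw [hb]
    refine ContinuousLinearMap.opNorm_le_bound _ (by positivity) fun v ↦ ?_
    have hd := (hG.differentiable (by simp) (e x)).mdifferentiableAt
    have h1 := mfderiv_comp x hd (he1.mdifferentiable one_ne_zero x)
    have h2 := congr($h1 v)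
    rw [mfderiv_eq_fderiv] at h2
    have h3 : mvfderiv I (fun x ↦ χ (s • (e x - e p))) x v =
      fderiv ℝ (fun z : EuclideanSpace ℝ (Fin N) ↦ χ (s • (z - e p))) (e x) (mvfderiv I e x v) := h2
    rw [h3]
    have h4 : ‖mvfderiv I e x‖ ≤ Ce := by
      have := hCe x
      rw [← ofReal_norm] at this
      simpa using ENNReal.ofReal_le_iff_le_toReal (by simp) |>.1 this
    calc _ ≤ B₀ * s * (Ce * ‖v‖) := by
          refine (ContinuousLinearMap.le_opNorm _ _).trans ?_
          refine mul_le_mul (hGd _) ?_ (norm_nonneg _) (by positivity)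
          exact (ContinuousLinearMap.le_opNorm _ _).trans
            (mul_le_mul_of_nonneg_right h4 (norm_nonneg _))
      _ ≤ _ := by
          rw [← mul_assoc]
          exact mul_le_mul_of_nonneg_right (le_add_of_nonneg_right (by positivity)) (norm_nonneg _)

/-- A smooth function with small derivative that vanishes on a `D`-separated finite set and is
comparable to `D` away from it. -/
theorem exists_smooth_penalty [IsRiemannianManifold I M] [FiniteDimensional ℝ E]
    [IsManifold I ∞ M] [CompactSpace M] {θ : ℝ} (hθ : 0 < θ) (hθ2 : θ < 1 / 2) :
    ∃ κ > (0 : ℝ), κ ≤ 1 ∧ ∀ (D : ℝ), 0 < D → ∀ O : Finset M,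
      (∀ p ∈ O, ∀ q ∈ O, p ≠ q → D ≤ dist p q) → ∃ w : M → ℝ, ContMDiff I 𝓘(ℝ, ℝ) ∞ w ∧
      (∀ x, 0 ≤ w x ∧ w x ≤ κ * D) ∧ (∀ p ∈ O, w p = 0) ∧
      (∀ x, (∀ p ∈ O, θ * D ≤ dist x p) → w x = κ * D) ∧ ∀ x, ‖mvfderiv I w x‖ ≤ 1 := by
  obtain ⟨B, hB, h⟩ := exists_scaled_bump (I := I) (M := M) hθ
  -- The height `κ * D` times the bump slope `B / D` must be at most 1.
  refine ⟨min 1 B⁻¹, lt_min one_pos (by positivity), min_le_left _ _, fun D hD O hO ↦ ?_⟩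
  set κ := min 1 B⁻¹
  have hκ0 : 0 < κ := lt_min one_pos (by positivity)
  choose b hbs hbp hb01 hb0 hbd using fun p ↦ h p D hD
  have hone : ∀ x, ∀ p ∈ O, dist x p < D / 2 → ∀ᶠ y in 𝓝 x, ∑ q ∈ O, b q y = b p y := by
    intro x p hp hxp
    have : ∀ᶠ y in 𝓝 x, dist y p < D / 2 :=
      ContinuousAt.eventually_lt (by fun_prop) (by fun_prop) hxp
    filter_upwards [this] with y hy
    refine Finset.sum_eq_single_of_mem p hp fun q hq hqp ↦ hb0 q y ?_
    have h1 := hO q hq p hp hqp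
    have h2 := dist_triangle_left q p y
    nlinarith
  have hzero : ∀ x, (∀ p ∈ O, D / 2 ≤ dist x p) → ∀ᶠ y in 𝓝 x, ∑ q ∈ O, b q y = 0 := by
    intro x hx
    have : ∀ᶠ y in 𝓝 x, ∀ p ∈ O, θ * D < dist y p := by
      rw [Filter.eventually_all_finset]
      intro p hp
      refine ContinuousAt.eventually_lt (by fun_prop) (by fun_prop) ?_
      have := hx p hp
      nlinarith
    filter_upwards [this] with y hy
    exact Finset.sum_eq_zero fun q hq ↦ hb0 q y (hy q hq).le
  -- As `θ < 1/2`, the supports are disjoint and near each point at most one bump is active. Thus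
  -- the derivative bound does not grow with the cardinality of `O`.
  have hcase : ∀ x, (∃ p ∈ O, ∀ᶠ y in 𝓝 x, ∑ q ∈ O, b q y = b p y) ∨
      ∀ᶠ y in 𝓝 x, ∑ q ∈ O, b q y = 0 := by
    intro x
    by_cases hx : ∃ p ∈ O, dist x p < D / 2
    · obtain ⟨p, hp, hxp⟩ := hx
      exact Or.inl ⟨p, hp, hone x p hp hxp⟩
    · push Not at hx
      exact Or.inr (hzero x hx)
  have hmd : ∀ p x, MDifferentiableAt I 𝓘(ℝ, ℝ) (b p) x := fun p x ↦
    (hbs p).mdifferentiable (by simp) x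
  refine ⟨fun x ↦ κ * D * (1 - ∑ p ∈ O, b p x), ?_, fun x ↦ ?_, fun p hp ↦ ?_, fun x hx ↦ ?_,
    fun x ↦ ?_⟩
  · exact contMDiff_const.mul (contMDiff_const.sub (contMDiff_finsetSum fun p _ ↦ hbs p))
  · have : 0 ≤ ∑ q ∈ O, b q x ∧ ∑ q ∈ O, b q x ≤ 1 := by
      rcases hcase x with ⟨p, hp, hx⟩ | hx
      · rw [hx.self_of_nhds]; exact hb01 p x
      · rw [hx.self_of_nhds]; norm_num
    have hκD : 0 < κ * D := by positivity
    constructor <;> nlinarith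
  · have : dist p p < D / 2 := by simpa using hD
    simp only [(hone p p hp this).self_of_nhds, hbp, sub_self, mul_zero]
  · simp only [Finset.sum_eq_zero fun q hq ↦ hb0 q x (hx q hq), sub_zero, mul_one]
  · rcases hcase x with ⟨p, hp, hx⟩ | hx
    · have hev : (fun x ↦ κ * D * (1 - ∑ p ∈ O, b p x)) =ᶠ[𝓝 x]
          ((fun _ ↦ κ * D) - (fun _ ↦ κ * D) * b p) := by
        filter_upwards [hx] with y hy
        simp only [hy, Pi.sub_apply, Pi.mul_apply]; ring
      have h1 : mvfderiv I (fun x ↦ κ * D * (1 - ∑ p ∈ O, b p x)) x =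
          -((κ * D) • mvfderiv I (b p) x) := by
        have h2 : mvfderiv I (fun x ↦ κ * D * (1 - ∑ p ∈ O, b p x)) x =
            mvfderiv I ((fun _ ↦ κ * D) - (fun _ ↦ κ * D) * b p) x := by
          ext v
          have := congr($(hev.mfderiv_eq (I := I) (I' := 𝓘(ℝ, ℝ))) v)
          exact this
        rw [h2, mvfderiv_sub mdifferentiableAt_const (mdifferentiableAt_const.mul (hmd p x)),
          mvfderiv_mul mdifferentiableAt_const (hmd p x), mvfderiv_const]
        simp
      refine ContinuousLinearMap.opNorm_le_bound _ zero_le_one fun v ↦ ?_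
      have h3 : mvfderiv I (fun x ↦ κ * D * (1 - ∑ p ∈ O, b p x)) x v =
          -(κ * D * mvfderiv I (b p) x v) := congr($h1 v)
      rw [h3, norm_neg, norm_mul, Real.norm_of_nonneg (by positivity)]
      calc κ * D * ‖mvfderiv I (b p) x v‖ ≤ B⁻¹ * D * (B / D * ‖v‖) := by
            gcongr
            · exact min_le_right _ _
            · exact (ContinuousLinearMap.le_opNorm _ _).trans
                (mul_le_mul_of_nonneg_right (hbd p x) (norm_nonneg _))
        _ = 1 * ‖v‖ := by field_simp
    · have hev : (fun x ↦ κ * D * (1 - ∑ p ∈ O, b p x)) =ᶠ[𝓝 x] fun _ ↦ κ * D := by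
        filter_upwards [hx] with y hy
        simp only [hy, sub_zero, mul_one]
      have h2 : mvfderiv I (fun x ↦ κ * D * (1 - ∑ p ∈ O, b p x)) x = 0 := by
        rw [← mvfderiv_const (I := I) (κ * D) (x := x)]
        ext v
        have := congr($(hev.mfderiv_eq (I := I) (I' := 𝓘(ℝ, ℝ))) v)
        exact this
      refine ContinuousLinearMap.opNorm_le_bound _ zero_le_one fun v ↦ ?_
      have h3 : mvfderiv I (fun x ↦ κ * D * (1 - ∑ p ∈ O, b p x)) x v = 0 := congr($h2 v)
      rw [h3, norm_zero]
      positivity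

end Penalty

/-! ### Periodic orbits and their gaps. -/

section Orbits

variable {X : Type*}

namespace IsPeriodicOrbit

variable {T : X → X} {O : Finset X}

theorem nonempty (hO : IsPeriodicOrbit T O) : O.Nonempty := by
  obtain ⟨p, -, h⟩ := hO
  refine ⟨p, ?_⟩
  rw [← Finset.mem_coe, h]
  exact ⟨0, rfl⟩

theorem map_mem (hO : IsPeriodicOrbit T O) {x : X} (hx : x ∈ O) : T x ∈ O := by
  obtain ⟨p, -, h⟩ := hO
  rw [← Finset.mem_coe, h] at hx ⊢
  obtain ⟨i, rfl⟩ := hx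
  exact ⟨i + 1, iterate_succ_apply' T i p⟩

theorem iterate_mem (hO : IsPeriodicOrbit T O) {x : X} (hx : x ∈ O) (i : ℕ) : T^[i] x ∈ O := by
  induction i with
  | zero => exact hx
  | succ i ih => rw [iterate_succ_apply']; exact hO.map_mem ih

theorem exists_iterate_eq (hO : IsPeriodicOrbit T O) {x y : X} (hx : x ∈ O) (hy : y ∈ O) :
    ∃ k, T^[k] x = y := by
  obtain ⟨p, hp, h⟩ := hO
  rw [← Finset.mem_coe, h] at hx hy
  obtain ⟨i, rfl⟩ := hx
  obtain ⟨j, rfl⟩ := hy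
  obtain ⟨n, hn, hpn⟩ := hp
  -- From `T^[i] p`, advance to time `n * i`, a multiple of the period, which returns to `p`; then
  -- take `j` more steps.
  refine ⟨j + (n * i - i), ?_⟩
  have hi : i ≤ n * i := Nat.le_mul_of_pos_left i hn
  simp only
  rw [← iterate_add_apply, add_assoc, Nat.sub_add_cancel hi, iterate_add_apply]
  congr 1
  exact hpn.mul_const i

theorem isPeriodicPt_card (hO : IsPeriodicOrbit T O) {x : X} (hx : x ∈ O) :
    IsPeriodicPt T O.card x ∧
      ∀ F : X → ℝ, ∑ i ∈ Finset.range O.card, F (T^[i] x) = ∑ y ∈ O, F y := by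
  classical
  have hxp : x ∈ periodicPts T := by
    obtain ⟨k, hk⟩ := hO.exists_iterate_eq (hO.map_mem hx) hx
    exact ⟨k + 1, k.succ_pos, by rw [IsPeriodicPt, IsFixedPt, iterate_succ_apply]; exact hk⟩
  have himg : (Finset.range (minimalPeriod T x)).image (fun i ↦ T^[i] x) = O := by
    ext y
    simp only [Finset.mem_image, Finset.mem_range]
    constructor
    · rintro ⟨i, -, rfl⟩
      exact hO.iterate_mem hx i
    · intro hy
      obtain ⟨k, rfl⟩ := hO.exists_iterate_eq hx hy
      exact ⟨k % minimalPeriod T x, Nat.mod_lt _ (minimalPeriod_pos_of_mem_periodicPts hxp),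
        iterate_mod_minimalPeriod_eq⟩
  have hinj : Set.InjOn (fun i ↦ T^[i] x) (Finset.range (minimalPeriod T x) : Set ℕ) := by
    intro i hi j hj hij
    simp only [Finset.coe_range, Set.mem_Iio] at hi hj
    exact (iterate_eq_iterate_iff_of_lt_minimalPeriod hi hj).1 hij
  have hcard : O.card = minimalPeriod T x := by
    rw [← himg, Finset.card_image_of_injOn hinj, Finset.card_range]
  refine ⟨?_, fun F ↦ ?_⟩
  · rw [hcard]; exact isPeriodicPt_minimalPeriod T x
  · rw [hcard]
    conv_rhs => rw [← himg]
    rw [Finset.sum_image hinj]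

/-- Birkhoff sums along a periodic orbit with vanishing total are bounded below. -/
theorem neg_card_mul_le_birkhoffSum (hO : IsPeriodicOrbit T O) {F : X → ℝ} {η : ℝ} (hη : 0 ≤ η)
    (hF : ∀ x ∈ O, -η ≤ F x) (hsum : ∑ x ∈ O, F x = 0) {x : X} (hx : x ∈ O) (m : ℕ) :
    -(O.card * η) ≤ birkhoffSum T F m x := by
  obtain ⟨hper, hs⟩ := hO.isPeriodicPt_card hx
  induction m using Nat.strong_induction_on with
  | _ m ih =>
    -- A full period contributes zero, so only an incomplete period of fewer than `O.card` terms
    -- counts.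
    by_cases hm : m < O.card
    · have h1 : ∑ i ∈ Finset.range m, -η ≤ birkhoffSum T F m x :=
        Finset.sum_le_sum fun i _ ↦ hF _ (hO.iterate_mem hx i)
      rw [Finset.sum_const, Finset.card_range, nsmul_eq_mul] at h1
      have h2 : (m : ℝ) ≤ O.card := by exact_mod_cast hm.le
      nlinarith
    · push Not at hm
      have h1 := ih (m - O.card) (Nat.sub_lt (hO.nonempty.card_pos.trans_le hm)
        hO.nonempty.card_pos)
      have h2 := birkhoffSum_add T F O.card (m - O.card) x
      rw [Nat.add_sub_cancel' hm, hper.eq] at h2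
      have h3 : birkhoffSum T F O.card x = 0 := (hs F).trans hsum
      rw [h2, h3, zero_add]
      exact h1

end IsPeriodicOrbit

variable [MetricSpace X]

theorem truncDist_nonneg {δ : ℝ} (hδ : 0 ≤ δ) (x y : X) : 0 ≤ truncDist δ x y := by
  unfold truncDist
  split_ifs
  exacts [hδ, dist_nonneg]

theorem gap_le_truncDist {δ : ℝ} (hδ : 0 ≤ δ) {O : Finset X} {x y : X} (hx : x ∈ O) (hy : y ∈ O)
    (hxy : x ≠ y) : gap δ O ≤ truncDist δ x y := by
  have hc : O.card ≠ 1 := by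
    intro h
    obtain ⟨a, rfl⟩ := Finset.card_eq_one.1 h
    simp only [Finset.mem_singleton] at hx hy
    exact hxy (hx.trans hy.symm)
  rw [gap, if_neg hc]
  refine csInf_le ⟨0, ?_⟩ ⟨x, hx, y, hy, hxy, rfl⟩
  rintro r ⟨a, -, b, -, -, rfl⟩
  exact truncDist_nonneg hδ a b

theorem gap_le_dist {δ : ℝ} (hδ : 0 ≤ δ) {O : Finset X} {x y : X} (hx : x ∈ O) (hy : y ∈ O)
    (hxy : x ≠ y) : gap δ O ≤ dist x y := by
  refine (gap_le_truncDist hδ hx hy hxy).trans ?_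
  unfold truncDist
  split_ifs with h
  exacts [h, le_rfl]

theorem gap_le_delta {δ : ℝ} (hδ : 0 ≤ δ) {O : Finset X} (hO : O.Nonempty) : gap δ O ≤ δ := by
  by_cases hc : O.card = 1
  · rw [gap, if_pos hc]
  · have h1 : 1 < O.card := by
      have := hO.card_pos
      omega
    obtain ⟨x, hx, y, hy, hxy⟩ := Finset.one_lt_card.1 h1
    refine (gap_le_truncDist hδ hx hy hxy).trans ?_
    unfold truncDist
    split_ifs with h
    exacts [le_rfl, (not_le.1 h).le]

namespace IsPeriodicOrbit

variable {T : X → X} {O : Finset X}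

/-- A point whose first iterates stay close to a separated periodic orbit follows it. -/
theorem dist_iterate_lt (hO : IsPeriodicOrbit T O) {Λ : ℝ≥0} (hT : LipschitzWith Λ T) {D r : ℝ}
    (hsep : ∀ p ∈ O, ∀ q ∈ O, p ≠ q → D ≤ dist p q) (hr : (Λ + 1) * r ≤ D) {x y : X}
    (hx : x ∈ O) (hxy : dist y x < r) {m : ℕ}
    (hnear : ∀ i ≤ m, ∃ p ∈ O, dist (T^[i] y) p < r) :
    ∀ i ≤ m, dist (T^[i] y) (T^[i] x) < r := by
  intro i hi
  induction i with
  | zero => exact hxy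
  | succ i ih =>
    obtain ⟨p, hp, hpy⟩ := hnear (i + 1) hi
    have h1 := ih (Nat.le_of_succ_le hi)
    -- Otherwise `O` has two distinct points within `r + Λ * r ≤ D` of each other, strictly.
    by_contra hcon
    have hne : p ≠ T^[i + 1] x := by
      rintro rfl
      exact hcon hpy
    have h2 := hsep p hp _ (hO.iterate_mem hx (i + 1)) hne
    have h3 : dist (T^[i + 1] y) (T^[i + 1] x) ≤ Λ * dist (T^[i] y) (T^[i] x) := by
      rw [iterate_succ_apply', iterate_succ_apply']
      exact hT.dist_le_mul _ _
    have h4 := dist_triangle_left p (T^[i + 1] x) (T^[i + 1] y)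
    have h5 : Λ * dist (T^[i] y) (T^[i] x) ≤ Λ * r := mul_le_mul_of_nonneg_left h1.le Λ.coe_nonneg
    linarith

end IsPeriodicOrbit

/-! ### Shadowing estimates and Birkhoff sums near a periodic orbit. -/

/-- Two geometric series, one from each end of the segment, dominate the sum; the bound is uniform
in the length `m`. -/
theorem sum_exp_min_le {lam : ℝ} (hlam : 0 < lam) (m : ℕ) :
    ∑ k ∈ Finset.range (m + 1), Real.exp (-lam * (min k (m - k) : ℕ)) ≤
      2 / (1 - Real.exp (-lam)) := by
  have hq1 : Real.exp (-lam) < 1 := by simpa using hlam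
  have hq0 := (Real.exp_pos (-lam)).le
  have hgeo : ∑ k ∈ Finset.range (m + 1), Real.exp (-lam) ^ k ≤ 1 / (1 - Real.exp (-lam)) := by
    rw [one_div, ← tsum_geometric_of_lt_one hq0 hq1]
    exact (summable_geometric_of_lt_one hq0 hq1).sum_le_tsum _ fun i _ ↦ pow_nonneg hq0 i
  have hexp : ∀ j : ℕ, Real.exp (-lam * j) = Real.exp (-lam) ^ j := fun j ↦ by
    rw [mul_comm, Real.exp_nat_mul]
  calc ∑ k ∈ Finset.range (m + 1), Real.exp (-lam * (min k (m - k) : ℕ))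
      ≤ ∑ k ∈ Finset.range (m + 1), (Real.exp (-lam) ^ k + Real.exp (-lam) ^ (m - k)) := by
        refine Finset.sum_le_sum fun k _ ↦ ?_
        rw [hexp]
        rcases min_choice k (m - k) with h | h <;> rw [h]
        · exact le_add_of_nonneg_right (pow_nonneg hq0 _)
        · exact le_add_of_nonneg_left (pow_nonneg hq0 _)
    _ = 2 * ∑ k ∈ Finset.range (m + 1), Real.exp (-lam) ^ k := by
        rw [Finset.sum_add_distrib, two_mul]
        congr 1
        have := Finset.sum_range_reflect (fun k ↦ Real.exp (-lam) ^ k) (m + 1)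
        simpa using this
    _ ≤ 2 / (1 - Real.exp (-lam)) := by
        rw [show 2 / (1 - Real.exp (-lam)) = 2 * (1 / (1 - Real.exp (-lam))) by ring]
        linarith

/-- The summability constant of the shadowing estimate. -/
noncomputable def shadowConst (lam C : ℝ) : ℝ := 4 * C / (1 - Real.exp (-lam)) + 1

theorem shadowConst_pos {lam C : ℝ} (hlam : 0 < lam) (hC : 0 < C) : 0 < shadowConst lam C := by
  have : 0 < 1 - Real.exp (-lam) := by simpa using hlam
  unfold shadowConst
  positivity

namespace IsASP

variable {T : X → X} {lam δ C L : ℝ}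

/-- Along two orbit segments that stay close, Birkhoff sums of a Lipschitz function differ by at
most a constant times the distance of the end points. -/
theorem birkhoffSum_le (hASP : IsASP T lam δ C L) {F : X → ℝ} {A : ℝ≥0} (hF : LipschitzWith A F)
    {x y : X} {m : ℕ} {s : ℝ} (hδ : ∀ i ≤ m, dist (T^[i] y) (T^[i] x) ≤ δ)
    (h0 : dist y x ≤ s) (hm : dist (T^[m] y) (T^[m] x) ≤ s) :
    birkhoffSum T F (m + 1) x - A * (shadowConst lam C * s) ≤ birkhoffSum T F (m + 1) y := by
  have hs : 0 ≤ s := dist_nonneg.trans h0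
  have hq : 0 < 1 - Real.exp (-lam) := by simpa using hASP.lam_pos
  have hsum : ∑ k ∈ Finset.range (m + 1), dist (T^[k] y) (T^[k] x) ≤ shadowConst lam C * s := by
    unfold shadowConst
    rw [add_mul, one_mul]
    -- The contraction estimate requires a positive length; for `m = 0` the summand 1 in
    -- `shadowConst` covers the single term.
    rcases Nat.eq_zero_or_pos m with rfl | hpos
    · have := hASP.C_pos
      have h1 : 0 ≤ 4 * C / (1 - Real.exp (-lam)) * s := by positivity
      simp only [zero_add, Finset.range_one, Finset.sum_singleton, iterate_zero, id]
      linarith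
    · calc ∑ k ∈ Finset.range (m + 1), dist (T^[k] y) (T^[k] x)
          ≤ ∑ k ∈ Finset.range (m + 1), C * (2 * s) * Real.exp (-lam * (min k (m - k) : ℕ)) := by
            refine Finset.sum_le_sum fun k hk ↦ ?_
            have h1 := hASP.contract m hpos y x hδ k (Nat.lt_succ_iff.1 (Finset.mem_range.1 hk))
            refine h1.trans ?_
            rw [mul_right_comm]
            refine mul_le_mul_of_nonneg_right ?_ (Real.exp_pos _).le
            exact mul_le_mul_of_nonneg_left (by linarith) hASP.C_pos.le
        _ = C * (2 * s) * ∑ k ∈ Finset.range (m + 1), Real.exp (-lam * (min k (m - k) : ℕ)) := by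
            rw [Finset.mul_sum]
        _ ≤ C * (2 * s) * (2 / (1 - Real.exp (-lam))) :=
            mul_le_mul_of_nonneg_left (sum_exp_min_le hASP.lam_pos m)
              (mul_nonneg hASP.C_pos.le (by linarith))
        _ = 4 * C / (1 - Real.exp (-lam)) * s := by ring
        _ ≤ _ := le_add_of_nonneg_right hs
  have hdiff : birkhoffSum T F (m + 1) x - birkhoffSum T F (m + 1) y ≤
      ∑ k ∈ Finset.range (m + 1), A * dist (T^[k] y) (T^[k] x) := by
    unfold birkhoffSum
    rw [← Finset.sum_sub_distrib]
    refine Finset.sum_le_sum fun k _ ↦ ?_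
    have h1 := hF.dist_le_mul (T^[k] x) (T^[k] y)
    rw [dist_comm (T^[k] x) (T^[k] y)] at h1
    exact (le_abs_self _).trans h1
  rw [← Finset.mul_sum] at hdiff
  have := mul_le_mul_of_nonneg_left hsum A.coe_nonneg
  linarith

end IsASP

/-- A normalized function near a periodic orbit `O`: it is almost nonnegative, has vanishing
average on `O`, is nonnegative at distance `s` from `O`, and is at least `G` at distance `r`. -/
structure IsPenalized (T : X → X) (O : Finset X) (F : X → ℝ) (A : ℝ≥0) (η s r G : ℝ) : Prop where
  lipschitz : LipschitzWith A F
  nonneg_η : 0 ≤ η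
  neg_le : ∀ x ∈ O, -η ≤ F x
  sum_eq_zero : ∑ x ∈ O, F x = 0
  nonneg : ∀ y, (∀ p ∈ O, s ≤ dist y p) → 0 ≤ F y
  le_of_far : ∀ y, (∀ p ∈ O, r ≤ dist y p) → G ≤ F y

namespace IsPenalized

variable {T : X → X} {O : Finset X} {F : X → ℝ} {A : ℝ≥0} {η s r G D lam δ C L : ℝ} {Λ : ℝ≥0}

/-- Final terms at distance at least `s` from `O` are nonnegative and can be dropped. What remains
is a segment with both ends `s`-close to `O`, and shadowing compares its sum with one along `O`. -/
theorem neg_le_birkhoffSum_of_near (hF : IsPenalized T O F A η s r G) (hASP : IsASP T lam δ C L)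
    (hO : IsPeriodicOrbit T O) (hT : LipschitzWith Λ T)
    (hsep : ∀ p ∈ O, ∀ q ∈ O, p ≠ q → D ≤ dist p q) (hs : 0 ≤ s) (hsr : s ≤ r)
    (hr : (Λ + 1) * r ≤ D) (hr2 : 2 * r ≤ D) (hrδ : r ≤ δ) {y : X} (hy : ∃ p ∈ O, dist y p < s)
    (m : ℕ) (hnear : ∀ i < m, ∃ p ∈ O, dist (T^[i] y) p < r) :
    -(O.card * η + A * (shadowConst lam C * s)) ≤ birkhoffSum T F m y := by
  have hE : 0 ≤ A * (shadowConst lam C * s) :=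
    mul_nonneg A.coe_nonneg (mul_nonneg (shadowConst_pos hASP.lam_pos hASP.C_pos).le hs)
  induction m with
  | zero =>
    have := hF.nonneg_η
    rw [birkhoffSum_zero]
    have : 0 ≤ O.card * η := by positivity
    linarith
  | succ m ih =>
    by_cases hend : ∃ q ∈ O, dist (T^[m] y) q < s
    · obtain ⟨x, hx, hxy⟩ := hy
      obtain ⟨q, hq, hqy⟩ := hend
      have hfol := hO.dist_iterate_lt hT hsep hr hx (hxy.trans_le hsr) (m := m)
        fun i hi ↦ hnear i (Nat.lt_succ_of_le hi)
      -- The close point at the end is the shadowed one: another point of `O` would be at distance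
      -- below `2 * r ≤ D` from it.
      have hqx : q = T^[m] x := by
        by_contra hne
        have h1 := hsep q hq _ (hO.iterate_mem hx m) hne
        have h2 := dist_triangle_left q (T^[m] x) (T^[m] y)
        have h3 := hfol m le_rfl
        linarith
      subst hqx
      have h1 := hASP.birkhoffSum_le hF.lipschitz
        (fun i hi ↦ ((hfol i hi).trans_le hrδ).le) hxy.le hqy.le
      have h2 := hO.neg_card_mul_le_birkhoffSum hF.nonneg_η hF.neg_le hF.sum_eq_zero hx (m + 1)
      linarith
    · push Not at hend
      have h1 := ih fun i hi ↦ hnear i (hi.trans m.lt_succ_self)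
      have h2 := hF.nonneg _ hend
      rw [birkhoffSum_succ]
      linarith

/-- Birkhoff sums dominate the number of visits far from the periodic orbit. -/
theorem neg_add_le_birkhoffSum (hF : IsPenalized T O F A η s r G) (hASP : IsASP T lam δ C L)
    (hO : IsPeriodicOrbit T O) (hT : LipschitzWith Λ T)
    (hsep : ∀ p ∈ O, ∀ q ∈ O, p ≠ q → D ≤ dist p q) (hs : 0 ≤ s) (hsr : s ≤ r)
    (hr : (Λ + 1) * r ≤ D) (hr2 : 2 * r ≤ D) (hrδ : r ≤ δ) {κ : ℝ}
    (hG : O.card * η + A * (shadowConst lam C * s) + κ ≤ G) (n : ℕ) (y : X) :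
    -(O.card * η + A * (shadowConst lam C * s)) +
      κ * birkhoffSum T ({y | ∀ p ∈ O, r ≤ dist y p}.indicator 1) n y ≤ birkhoffSum T F n y := by
  set E := O.card * η + A * (shadowConst lam C * s) with hE_def
  set B : Set X := {y | ∀ p ∈ O, r ≤ dist y p} with hB
  have hE : 0 ≤ E := by
    have h1 : 0 ≤ A * (shadowConst lam C * s) :=
      mul_nonneg A.coe_nonneg (mul_nonneg (shadowConst_pos hASP.lam_pos hASP.C_pos).le hs)
    have := hF.nonneg_η
    have : 0 ≤ O.card * η := by positivity
    linarith
  induction n using Nat.strong_induction_on generalizing y with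
  | _ n ih =>
    rcases Nat.eq_zero_or_pos n with rfl | hn
    · simpa using hE
    by_cases hy : ∃ p ∈ O, dist y p < s
    -- Cut at the first visit to `B`: its value, at least `E + κ`, repays the loss `E` before it and
    -- counts the visit, and the induction restarts right after.
    · by_cases hj : ∃ j, j < n ∧ T^[j] y ∈ B
      · classical
        obtain ⟨hjn, hjB⟩ := Nat.find_spec hj
        have hmin : ∀ i < Nat.find hj, T^[i] y ∉ B := fun i hi hiB ↦
          Nat.find_min hj hi ⟨hi.trans hjn, hiB⟩
        set j := Nat.find hj
        have h1 := hF.neg_le_birkhoffSum_of_near hASP hO hT hsep hs hsr hr hr2 hrδ hy j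
          fun i hi ↦ by
            have := hmin i hi
            simp only [hB, mem_ofPred_eq] at this
            push Not at this
            exact this
        have h2 := hF.le_of_far _ hjB
        have h3 := ih (n - (j + 1)) (by omega) (T^[j + 1] y)
        have hadd : ∀ g : X → ℝ, birkhoffSum T g n y =
            birkhoffSum T g j y + g (T^[j] y) + birkhoffSum T g (n - (j + 1)) (T^[j + 1] y) := by
          intro g
          rw [← birkhoffSum_succ, ← birkhoffSum_add, Nat.add_sub_cancel' hjn]
        have h4 : birkhoffSum T (B.indicator (1 : X → ℝ)) j y = 0 :=
          Finset.sum_eq_zero fun i hi ↦ indicator_of_notMem (hmin i (Finset.mem_range.1 hi)) _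
        rw [hadd F, hadd (B.indicator 1), h4, indicator_of_mem hjB, Pi.one_apply]
        linarith
      · push Not at hj
        have h1 := hF.neg_le_birkhoffSum_of_near hASP hO hT hsep hs hsr hr hr2 hrδ hy n
          fun i hi ↦ by
            have := hj i hi
            simp only [hB, mem_ofPred_eq] at this
            push Not at this
            exact this
        have h4 : birkhoffSum T (B.indicator (1 : X → ℝ)) n y = 0 :=
          Finset.sum_eq_zero fun i hi ↦ indicator_of_notMem (hj i (Finset.mem_range.1 hi)) _
        rw [h4, mul_zero, add_zero]
        exact h1
    · push Not at hy
      obtain ⟨k, rfl⟩ := Nat.exists_eq_succ_of_ne_zero hn.ne'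
      have h1 := ih k k.lt_succ_self (T y)
      -- Starting at distance at least `s` costs nothing, so one step is peeled off.
      have h2 : κ * B.indicator 1 y ≤ F y := by
        by_cases hyB : y ∈ B
        · rw [indicator_of_mem hyB, Pi.one_apply, mul_one]
          exact (by linarith : κ ≤ G).trans (hF.le_of_far y hyB)
        · rw [indicator_of_notMem hyB, mul_zero]
          exact hF.nonneg y hy
      rw [Nat.succ_eq_add_one, birkhoffSum_succ', birkhoffSum_succ', mul_add]
      linarith

end IsPenalized

end Orbits

/-! ### Invariant measures: from Birkhoff sums to integrals and uniqueness. -/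

section InvariantMeasures

open Filter Topology

variable {X : Type*} {T : X → X} {O : Finset X}

theorem map_image_eq_of_isPeriodicOrbit [DecidableEq X] (hO : IsPeriodicOrbit T O) :
    O.image T = O := by
  ext y
  rw [Finset.mem_image]
  constructor
  · rintro ⟨x, hx, rfl⟩
    exact hO.map_mem hx
  · intro hy
    obtain ⟨k, hk⟩ := hO.exists_iterate_eq (hO.map_mem hy) hy
    exact ⟨T^[k] y, hO.iterate_mem hy k, by rw [← iterate_succ_apply' T k y, iterate_succ_apply]; exact hk⟩

variable [MeasurableSpace X] {ν : Measure X}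

theorem isProbabilityMeasure_orbitMeasure (hO : O.Nonempty) :
    IsProbabilityMeasure (orbitMeasure O) := by
  constructor
  have h0 : (O.card : ℝ≥0∞) ≠ 0 := by exact_mod_cast hO.card_pos.ne'
  simp [orbitMeasure, ENNReal.inv_mul_cancel h0]

variable [MetricSpace X] [BorelSpace X]

theorem orbitMeasure_mem_invariantMeasures (hO : IsPeriodicOrbit T O) (hT : Continuous T) :
    orbitMeasure O ∈ invariantMeasures T := by
  classical
  refine ⟨isProbabilityMeasure_orbitMeasure hO.nonempty, hT.measurable, ?_⟩
  have himg := map_image_eq_of_isPeriodicOrbit hO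
  have hinj : Set.InjOn T (O : Set X) := Finset.card_image_iff.1 (by rw [himg])
  unfold orbitMeasure
  rw [Measure.map_smul]
  congr 1
  rw [← Measure.mapₗ_apply_of_measurable hT.measurable, map_sum]
  simp only [Measure.mapₗ_apply_of_measurable hT.measurable, Measure.map_dirac' hT.measurable]
  conv_rhs => rw [← himg]
  rw [Finset.sum_image hinj]

/-- By invariance the mass of a point cannot decrease along its orbit; on a periodic orbit it is
therefore constant. -/
theorem eq_orbitMeasure_of_measure_compl_eq_zero (hν : ν ∈ invariantMeasures T)
    (hO : IsPeriodicOrbit T O) (h : ν (O : Set X)ᶜ = 0) : ν = orbitMeasure O := by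
  have hprob := hν.1
  have hle : ∀ x, ν {x} ≤ ν {T x} := fun x ↦ by
    rw [← hν.2.measure_preimage (measurableSet_singleton (T x)).nullMeasurableSet]
    exact measure_mono (by simp)
  have hle' : ∀ x k, ν {x} ≤ ν {T^[k] x} := fun x k ↦ by
    induction k with
    | zero => exact le_rfl
    | succ k ih => rw [iterate_succ_apply']; exact ih.trans (hle _)
  obtain ⟨p, hp⟩ := hO.nonempty
  have hconst : ∀ x ∈ O, ν {x} = ν {p} := fun x hx ↦ by
    obtain ⟨k, hk⟩ := hO.exists_iterate_eq hx hp
    obtain ⟨l, hl⟩ := hO.exists_iterate_eq hp hx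
    exact le_antisymm (hk ▸ hle' x k) (hl ▸ hle' p l)
  have hfin : ∀ s : Finset X, (s : Set X) ⊆ O → ν (s : Set X) = s.card * ν {p} := fun s hs ↦ by
    rw [← sum_measure_singleton, Finset.sum_congr rfl fun x hx ↦ hconst x (hs hx),
      Finset.sum_const, nsmul_eq_mul]
  have h0 : (O.card : ℝ≥0∞) ≠ 0 := by exact_mod_cast hO.nonempty.card_pos.ne'
  have hval : ν {p} = (O.card : ℝ≥0∞)⁻¹ := by
    have h1 : ν (O : Set X) = 1 := (prob_compl_eq_zero_iff O.measurableSet).1 h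
    rw [hfin O subset_rfl, mul_comm] at h1
    exact ENNReal.eq_inv_of_mul_eq_one_left h1
  classical
  ext s hs
  have h1 : ν s = ν ((O.filter (· ∈ s) : Finset X) : Set X) := by
    refine measure_congr ?_
    have hae : ∀ᵐ x ∂ν, x ∈ (O : Set X) := h
    filter_upwards [hae] with x hx
    exact propext ⟨fun hxs ↦ Finset.mem_coe.2 (Finset.mem_filter.2 ⟨hx, hxs⟩),
      fun hxs ↦ (Finset.mem_filter.1 (Finset.mem_coe.1 hxs)).2⟩
  rw [h1, hfin _ (fun x hx ↦ (Finset.mem_filter.1 (Finset.mem_coe.1 hx)).1), hval]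
  simp only [orbitMeasure, Measure.smul_apply, Measure.finsetSum_apply,
    Measure.dirac_apply' _ hs, smul_eq_mul, indicator_apply, Pi.one_apply, Finset.sum_boole]
  rw [mul_comm]

theorem integral_comp_iterate (hν : ν ∈ invariantMeasures T) {F : X → ℝ} (hF : Continuous F)
    (i : ℕ) : ∫ x, F (T^[i] x) ∂ν = ∫ x, F x ∂ν := by
  have hi := hν.2.iterate i
  conv_rhs => rw [← hi.map_eq]
  rw [integral_map hi.measurable.aemeasurable hF.measurable.aestronglyMeasurable]

variable [CompactSpace X]

theorem integrable_of_continuous [IsFiniteMeasure ν] {F : X → ℝ} (hF : Continuous F) :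
    Integrable F ν :=
  hF.integrable_of_hasCompactSupport (HasCompactSupport.of_compactSpace F)

theorem integral_pos_of_continuous_of_pos {ν : Measure X} [IsProbabilityMeasure ν] {ψ : X → ℝ}
    (hψ : Continuous ψ) (hψpos : ∀ x, 0 < ψ x) : 0 < ∫ x, ψ x ∂ν := by
  rw [integral_pos_iff_support_of_nonneg (fun x ↦ (hψpos x).le) (integrable_of_continuous hψ)]
  have : support ψ = univ := by ext x; simp [(hψpos x).ne']
  simp [this]

theorem integral_birkhoffSum (hν : ν ∈ invariantMeasures T) (hT : Continuous T) {F : X → ℝ}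
    (hF : Continuous F) (n : ℕ) :
    ∫ x, birkhoffSum T F n x ∂ν = n * ∫ x, F x ∂ν := by
  have := hν.1
  unfold birkhoffSum
  rw [integral_finsetSum _ fun i _ ↦
    integrable_of_continuous (F := fun x ↦ F (T^[i] x)) (hF.comp (hT.iterate i))]
  simp only [integral_comp_iterate hν hF, Finset.sum_const, Finset.card_range, nsmul_eq_mul]

theorem integral_birkhoffAverage (hν : ν ∈ invariantMeasures T) (hT : Continuous T) {F : X → ℝ}
    (hF : Continuous F) {K : ℕ} (hK : 1 ≤ K) :
    ∫ x, birkhoffAverage ℝ T F K x ∂ν = ∫ x, F x ∂ν := by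
  have hK0 : (K : ℝ) ≠ 0 := by positivity
  simp only [birkhoffAverage, smul_eq_mul]
  rw [integral_const_mul, integral_birkhoffSum hν hT hF, inv_mul_cancel_left₀ hK0]

/-- After integration both main terms grow linearly in `n` by invariance, while `E` stays fixed and
becomes negligible. -/
theorem mul_measureReal_le_integral (hν : ν ∈ invariantMeasures T) (hT : Continuous T) {F : X → ℝ}
    (hF : Continuous F) {B : Set X} (hB : IsClosed B) {E κ : ℝ}
    (h : ∀ n y, -E + κ * birkhoffSum T (B.indicator 1) n y ≤ birkhoffSum T F n y) :
    κ * ν.real B ≤ ∫ x, F x ∂ν := by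
  have hprob := hν.1
  have hind : ∀ i, Integrable (fun x ↦ B.indicator (1 : X → ℝ) (T^[i] x)) ν := fun i ↦ by
    have h1 : Integrable (B.indicator (1 : X → ℝ)) ν :=
      (integrable_const (1 : ℝ)).indicator hB.measurableSet
    exact (hν.2.iterate i).integrable_comp_of_integrable h1
  have hindint : ∀ i, ∫ x, B.indicator (1 : X → ℝ) (T^[i] x) ∂ν = ν.real B := fun i ↦ by
    have hi := hν.2.iterate i
    have h1 : ∫ x, B.indicator (1 : X → ℝ) x ∂ν = ν.real B := integral_indicator_one hB.measurableSet
    rw [← h1]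
    conv_rhs => rw [← hi.map_eq]
    have h2 : Measurable (B.indicator (1 : X → ℝ)) := measurable_one.indicator hB.measurableSet
    rw [integral_map hi.measurable.aemeasurable h2.aestronglyMeasurable]
  have hn : ∀ n : ℕ, -E + κ * (n * ν.real B) ≤ n * ∫ x, F x ∂ν := by
    intro n
    have hsumint : ∫ x, birkhoffSum T (B.indicator (1 : X → ℝ)) n x ∂ν = n * ν.real B := by
      unfold birkhoffSum
      rw [integral_finsetSum _ fun i _ ↦ hind i]
      simp [hindint]
    have hint : Integrable (fun x ↦ birkhoffSum T (B.indicator (1 : X → ℝ)) n x) ν :=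
      integrable_finsetSum _ fun i _ ↦ hind i
    rw [← integral_birkhoffSum hν hT hF, ← hsumint, ← integral_const_mul]
    have hconst : -E = ∫ _x, -E ∂ν := by simp
    rw [hconst, ← integral_add (integrable_const _) (hint.const_mul κ)]
    refine integral_mono ((integrable_const _).add (hint.const_mul κ)) ?_ fun y ↦ h n y
    exact integrable_finsetSum _ fun i _ ↦ integrable_of_continuous (hF.comp (hT.iterate i))
  by_contra hcon
  push Not at hcon
  obtain ⟨n, hn'⟩ := exists_nat_gt (E / (κ * ν.real B - ∫ x, F x ∂ν))
  rw [div_lt_iff₀ (by linarith)] at hn'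
  have := hn n
  nlinarith

theorem integral_orbitMeasure {F : X → ℝ} (hF : Continuous F) :
    ∫ x, F x ∂(orbitMeasure O) = (O.card : ℝ)⁻¹ * ∑ x ∈ O, F x := by
  unfold orbitMeasure
  rw [integral_smul_measure, integral_finsetSum_measure fun x _ ↦ integrable_of_continuous hF]
  simp

/-- An invariant measure that gives no mass to the points far from a periodic orbit is carried by
this orbit. -/
theorem measure_compl_eq_zero_of_near {Λ : ℝ≥0} {lam δ C L D r : ℝ} (hν : ν ∈ invariantMeasures T)
    (hASP : IsASP T lam δ C L) (hO : IsPeriodicOrbit T O) (hT : LipschitzWith Λ T)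
    (hsep : ∀ p ∈ O, ∀ q ∈ O, p ≠ q → D ≤ dist p q) (hr : (Λ + 1) * r ≤ D) (hrδ : r ≤ δ)
    (h : ν {y | ∀ p ∈ O, r ≤ dist y p} = 0) : ν (O : Set X)ᶜ = 0 := by
  have hprob := hν.1
  have hnear : ∀ᵐ y ∂ν, ∀ i, ∃ p ∈ O, dist (T^[i] y) p < r := by
    rw [ae_all_iff]
    intro i
    have h1 : ∀ᵐ y ∂ν, ∃ p ∈ O, dist y p < r := by
      rw [ae_iff]; simpa using h
    exact (hν.2.iterate i).quasiMeasurePreserving.ae h1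
  have hcont : Continuous fun y ↦ Metric.infDist y (O : Set X) := Metric.continuous_infDist_pt _
  have hbound : ∀ k : ℕ, ∫ y, Metric.infDist y (O : Set X) ∂ν ≤
      C * (δ + δ) * Real.exp (-lam) ^ k := by
    intro k
    -- Invariance moves the integral to time `k`, the middle of a segment of length `2 * k + 1`
    -- whose ends are within `δ` of `O`; there the contraction factor is `exp (-lam * k)`.
    rw [← integral_comp_iterate hν hcont k]
    have hc : C * (δ + δ) * Real.exp (-lam) ^ k =
        ∫ _y, C * (δ + δ) * Real.exp (-lam) ^ k ∂ν := by simp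
    rw [hc]
    refine integral_mono_ae
      (integrable_of_continuous (hcont.comp (hT.continuous.iterate k))) (integrable_const _) ?_
    filter_upwards [hnear] with y hy
    obtain ⟨x, hx, hxy⟩ := hy 0
    have hfol : ∀ i, dist (T^[i] y) (T^[i] x) ≤ δ := fun i ↦
      ((hO.dist_iterate_lt hT hsep hr hx hxy (m := i) fun j _ ↦ hy j) i le_rfl).le.trans hrδ
    have h1 := hASP.contract (2 * k + 1) (by omega) y x (fun i _ ↦ hfol i) k (by omega)
    have hmin : min k (2 * k + 1 - k) = k := by omega
    rw [hmin, mul_comm (-lam), Real.exp_nat_mul] at h1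
    refine (Metric.infDist_le_dist_of_mem (Finset.mem_coe.2 (hO.iterate_mem hx k))).trans
      (h1.trans ?_)
    rw [mul_right_comm]
    refine mul_le_mul_of_nonneg_right ?_ (pow_nonneg (Real.exp_pos _).le _)
    exact mul_le_mul_of_nonneg_left (add_le_add (hfol 0) (hfol _)) hASP.C_pos.le
  have hlim : Tendsto (fun k : ℕ ↦ C * (δ + δ) * Real.exp (-lam) ^ k) atTop (𝓝 0) := by
    have := (tendsto_pow_atTop_nhds_zero_of_lt_one (Real.exp_pos (-lam)).le
      (by simpa using hASP.lam_pos)).const_mul (C * (δ + δ))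
    simpa using this
  have hle : ∫ y, Metric.infDist y (O : Set X) ∂ν ≤ 0 :=
    ge_of_tendsto' hlim hbound
  have hzero : ∫ y, Metric.infDist y (O : Set X) ∂ν = 0 :=
    le_antisymm hle (integral_nonneg fun y ↦ Metric.infDist_nonneg)
  rw [integral_eq_zero_iff_of_nonneg (fun y ↦ Metric.infDist_nonneg)
    (integrable_of_continuous hcont)] at hzero
  have : ∀ᵐ y ∂ν, y ∈ (O : Set X) := by
    filter_upwards [hzero] with y hy
    exact (O.finite_toSet.isClosed.mem_iff_infDist_zero (by exact_mod_cast hO.nonempty)).2 hy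
  exact this

/-- The orbit measure is the only invariant measure with nonpositive integral of a penalized
function. -/
theorem IsPenalized.integral_nonneg {F : X → ℝ} {A Λ : ℝ≥0} {η s r G D lam δ C L κ : ℝ}
    (hF : IsPenalized T O F A η s r G) (hν : ν ∈ invariantMeasures T) (hASP : IsASP T lam δ C L)
    (hO : IsPeriodicOrbit T O) (hT : LipschitzWith Λ T)
    (hsep : ∀ p ∈ O, ∀ q ∈ O, p ≠ q → D ≤ dist p q) (hs : 0 ≤ s) (hsr : s ≤ r)
    (hr : (Λ + 1) * r ≤ D) (hr2 : 2 * r ≤ D) (hrδ : r ≤ δ) (hκ : 0 < κ)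
    (hG : O.card * η + A * (shadowConst lam C * s) + κ ≤ G) :
    0 ≤ ∫ x, F x ∂ν ∧ (∫ x, F x ∂ν ≤ 0 → ν = orbitMeasure O) := by
  have hprob := hν.1
  have hB : IsClosed {y : X | ∀ p ∈ O, r ≤ dist y p} := by
    simp only [ofPred_forall]
    exact isClosed_biInter fun p _ ↦ isClosed_le continuous_const (by fun_prop)
  have h1 := mul_measureReal_le_integral hν hT.continuous hF.lipschitz.continuous hB
    (hF.neg_add_le_birkhoffSum hASP hO hT hsep hs hsr hr hr2 hrδ hG)
  have h2 : 0 ≤ ν.real {y : X | ∀ p ∈ O, r ≤ dist y p} := measureReal_nonneg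
  refine ⟨(mul_nonneg hκ.le h2).trans h1, fun hle ↦ ?_⟩
  have h3 : ν.real {y : X | ∀ p ∈ O, r ≤ dist y p} = 0 := by nlinarith
  rw [measureReal_eq_zero_iff] at h3
  exact eq_orbitMeasure_of_measure_compl_eq_zero hν hO
    (measure_compl_eq_zero_of_near hν hASP hO hT hsep hr hrδ h3)

/-- If `u - a ψ` has nonnegative integral against all invariant measures, vanishing only at
`μ`, then `μ` is the unique minimizing measure for `(u, ψ)`. -/
theorem minimizingMeasures_eq_singleton {u ψ : X → ℝ} (hu : Continuous u) (hψ : Continuous ψ)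
    (hψpos : ∀ x, 0 < ψ x) {μ : Measure X} (hμ : μ ∈ invariantMeasures T) {a : ℝ}
    (ha : ∫ x, u x ∂μ = a * ∫ x, ψ x ∂μ)
    (h : ∀ ν ∈ invariantMeasures T,
      0 ≤ ∫ x, (u x - a * ψ x) ∂ν ∧ (∫ x, (u x - a * ψ x) ∂ν ≤ 0 → ν = μ)) :
    minimizingMeasures T u ψ = {μ} := by
  have hpos : ∀ ν ∈ invariantMeasures T, 0 < ∫ x, ψ x ∂ν := fun ν hν ↦ by
    have := hν.1
    exact integral_pos_of_continuous_of_pos hψ hψpos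
  have hsub : ∀ ν ∈ invariantMeasures T,
      ∫ x, (u x - a * ψ x) ∂ν = ∫ x, u x ∂ν - a * ∫ x, ψ x ∂ν := fun ν hν ↦ by
    have := hν.1
    rw [integral_sub (integrable_of_continuous hu) ((integrable_of_continuous hψ).const_mul a),
      integral_const_mul]
  have hval : (∫ x, u x ∂μ) / ∫ x, ψ x ∂μ = a := by
    rw [ha, mul_div_cancel_right₀ _ (hpos μ hμ).ne']
  have hleast : IsLeast ((fun ν : Measure X => (∫ x, u x ∂ν) / ∫ x, ψ x ∂ν) ''
      invariantMeasures T) a := by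
    refine ⟨⟨μ, hμ, hval⟩, ?_⟩
    rintro _ ⟨ν, hν, rfl⟩
    simp only
    rw [le_div_iff₀ (hpos ν hν)]
    have := (h ν hν).1
    rw [hsub ν hν] at this
    linarith
  have hmin : minRatioAverage T u ψ = a := hleast.csInf_eq
  ext ν
  simp only [minimizingMeasures, hmin, mem_singleton_iff]
  constructor
  · rintro ⟨hν, hνa⟩
    refine (h ν hν).2 ?_
    rw [hsub ν hν]
    rw [div_eq_iff (hpos ν hν).ne'] at hνa
    linarith
  · rintro rfl
    exact ⟨hμ, hval⟩

end InvariantMeasures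

/-! ### Normalization by a coboundary and the quantitative core. -/

section Subaction

open Filter Topology

variable {X : Type*} [MetricSpace X]

theorem lipschitzWith_birkhoffAverage {T : X → X} {Λ a : ℝ≥0} (hΛ : 1 ≤ Λ)
    (hT : LipschitzWith Λ T) {g : X → ℝ} (hg : LipschitzWith a g) {K : ℕ} (hK : 1 ≤ K) :
    LipschitzWith (a * Λ ^ K) (birkhoffAverage ℝ T g K) := by
  have hK0 : (0 : ℝ) < K := by exact_mod_cast hK
  refine LipschitzWith.of_dist_le_mul fun x y ↦ ?_
  simp only [birkhoffAverage, smul_eq_mul, birkhoffSum]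
  rw [Real.dist_eq, ← mul_sub, ← Finset.sum_sub_distrib, abs_mul, abs_of_nonneg (by positivity),
    inv_mul_le_iff₀ hK0]
  refine (Finset.abs_sum_le_sum_abs _ _).trans ?_
  have hterm : ∀ i ∈ Finset.range K, |g (T^[i] x) - g (T^[i] y)| ≤
      ((a * Λ ^ K : ℝ≥0) : ℝ) * dist x y := by
    intro i hi
    have h1 := (hg.comp (hT.iterate i)).dist_le_mul x y
    refine h1.trans (mul_le_mul_of_nonneg_right ?_ dist_nonneg)
    rw [NNReal.coe_le_coe]
    exact mul_le_mul_right (pow_le_pow_right₀ hΛ (Finset.mem_range.1 hi).le) a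
  refine (Finset.sum_le_sum hterm).trans (le_of_eq ?_)
  simp

variable [CompactSpace X] [MeasurableSpace X] [BorelSpace X] {T : X → X}

/-- The infimum of the ratio ergodic averages is attained. -/
theorem exists_isLeast_ratio (hT : Continuous T) (hne : (invariantMeasures T).Nonempty)
    {u ψ : X → ℝ} (hu : Continuous u) (hψ : Continuous ψ) (hψpos : ∀ x, 0 < ψ x) :
    ∃ ν ∈ minimizingMeasures T u ψ, ∀ ν' ∈ invariantMeasures T,
      (∫ x, u x ∂ν) / (∫ x, ψ x ∂ν) ≤ (∫ x, u x ∂ν') / (∫ x, ψ x ∂ν') := by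
  -- Invariant measures form a weakly compact set on which the ratio is continuous, since `∫ ψ` is
  -- positive.
  let S : Set (ProbabilityMeasure X) := {μ | μ.map hT.measurable.aemeasurable = μ}
  have hS : IsCompact S :=
    (isClosed_eq (ProbabilityMeasure.continuous_map hT) continuous_id).isCompact
  have hint : ∀ {g : X → ℝ}, Continuous g →
      Continuous fun μ : ProbabilityMeasure X ↦ ∫ x, g x ∂(μ : Measure X) := fun {g} hg ↦
    ProbabilityMeasure.continuous_integral_boundedContinuousFunction
      (BoundedContinuousFunction.mkOfCompact ⟨g, hg⟩)
  have hmem : ∀ ν (hν : ν ∈ invariantMeasures T), (⟨ν, hν.1⟩ : ProbabilityMeasure X) ∈ S :=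
    fun ν hν ↦ Subtype.ext hν.2.map_eq
  obtain ⟨ν₀, hν₀⟩ := hne
  obtain ⟨μ, hμS, hμ⟩ := hS.exists_isMinOn ⟨_, hmem ν₀ hν₀⟩
    ((hint hu).div (hint hψ) fun μ ↦ (integral_pos_of_continuous_of_pos hψ hψpos).ne').continuousOn
  have hμinv : (μ : Measure X) ∈ invariantMeasures T :=
    ⟨μ.2, hT.measurable, congrArg Subtype.val hμS⟩
  have hle : ∀ ν' ∈ invariantMeasures T, (∫ x, u x ∂(μ : Measure X)) / (∫ x, ψ x ∂(μ : Measure X)) ≤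
      (∫ x, u x ∂ν') / (∫ x, ψ x ∂ν') := fun ν' hν' ↦ isMinOn_iff.1 hμ _ (hmem ν' hν')
  refine ⟨μ, ⟨hμinv, ?_⟩, hle⟩
  have hleast : IsLeast ((fun ν : Measure X => (∫ x, u x ∂ν) / ∫ x, ψ x ∂ν) ''
      invariantMeasures T) ((∫ x, u x ∂(μ : Measure X)) / ∫ x, ψ x ∂(μ : Measure X)) := by
    refine ⟨⟨μ, hμinv, rfl⟩, ?_⟩
    rintro _ ⟨ν, hν, rfl⟩
    exact hle ν hν
  exact hleast.csInf_eq.symm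

/-- Normalization of `u - β ψ` by a coboundary: a nonnegative Lipschitz function with the same
integrals, controlled by the distance to the minimizing set. -/
theorem exists_normalization {Λ : ℝ≥0} (hΛ : 1 ≤ Λ) (hT : LipschitzWith Λ T) (hM : IsMCGBP T)
    (hne : (invariantMeasures T).Nonempty) {u ψ : X → ℝ} {Lu Lψ : ℝ≥0} (hu : LipschitzWith Lu u)
    (hψ : LipschitzWith Lψ ψ) (hψpos : ∀ x, 0 < ψ x) :
    ∃ (K : ℕ) (β : ℝ) (A : ℝ≥0) (g : X → ℝ), 1 ≤ K ∧ 0 < A ∧ LipschitzWith A g ∧ (∀ x, 0 ≤ g x) ∧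
      (∀ ν ∈ invariantMeasures T, ∫ x, g x ∂ν = ∫ x, (u x - β * ψ x) ∂ν) ∧
      ∀ x, g x ≤ A * Metric.infDist x (minimizingSet T u ψ) := by
  obtain ⟨ν₀, hν₀, hmin⟩ := exists_isLeast_ratio hT.continuous hne hu.continuous hψ.continuous hψpos
  set β := (∫ x, u x ∂ν₀) / (∫ x, ψ x ∂ν₀)
  have hpos : ∀ ν ∈ invariantMeasures T, 0 < ∫ x, ψ x ∂ν := fun ν hν ↦
    have := hν.1
    integral_pos_of_continuous_of_pos hψ.continuous hψpos
  have hsub : ∀ ν ∈ invariantMeasures T,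
      ∫ x, (u x - β * ψ x) ∂ν = ∫ x, u x ∂ν - β * ∫ x, ψ x ∂ν := fun ν hν ↦ by
    have := hν.1
    rw [integral_sub (integrable_of_continuous hu.continuous)
      ((integrable_of_continuous hψ.continuous).const_mul β), integral_const_mul]
  have hratio : minRatioAverage T u ψ = β := hν₀.2.symm
  have hminzero : ∀ ν ∈ minimizingMeasures T u ψ, ∫ x, (u x - β * ψ x) ∂ν = 0 := fun ν hν ↦ by
    have h1 := hν.2
    rw [hratio, div_eq_iff (hpos ν hν.1).ne'] at h1
    rw [hsub ν hν.1, h1, sub_self]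
  -- Minimality of the ratio `β` makes the ordinary minimum average of `u - βψ` zero, so the MCGBP
  -- inequality has no constant left.
  have havg : minAverage T (fun x ↦ u x - β * ψ x) = 0 := by
    refine IsLeast.csInf_eq ⟨⟨ν₀, hν₀.1, hminzero ν₀ hν₀⟩, ?_⟩
    rintro _ ⟨ν, hν, rfl⟩
    have h1 := hmin ν hν
    rw [le_div_iff₀ (hpos ν hν)] at h1
    simp only [hsub ν hν]
    linarith
  have hlip : LipschitzWith (Lu + ‖β‖₊ * Lψ) fun x ↦ u x - β * ψ x := by
    refine hu.sub ?_
    exact (lipschitzWith_smul β).comp hψ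
  obtain ⟨K, hK, hsubact⟩ := hM 1 one_pos le_rfl
  obtain ⟨v, ⟨Lv, hv⟩, hvnn⟩ := hsubact _ ⟨_, holderWith_one.2 hlip⟩
  rw [holderWith_one] at hv
  rw [havg] at hvnn
  set g : X → ℝ := fun x ↦ birkhoffAverage ℝ T (fun x ↦ u x - β * ψ x) K x - v (T^[K] x) + v x
    with hg
  have hgnn : ∀ x, 0 ≤ g x := fun x ↦ by simpa using hvnn x
  have hglip := ((lipschitzWith_birkhoffAverage hΛ hT hlip hK).sub (hv.comp (hT.iterate K))).add hv
  set A₀ : ℝ≥0 := (Lu + ‖β‖₊ * Lψ) * Λ ^ K + Lv * Λ ^ K + Lv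
  have hglip' : LipschitzWith (A₀ + 1) g := hglip.weaken le_self_add
  have hgint : ∀ ν ∈ invariantMeasures T, ∫ x, g x ∂ν = ∫ x, (u x - β * ψ x) ∂ν := fun ν hν ↦ by
    have := hν.1
    have hc1 : Continuous (birkhoffAverage ℝ T (fun x ↦ u x - β * ψ x) K) :=
      (lipschitzWith_birkhoffAverage hΛ hT hlip hK).continuous
    have hc2 : Continuous fun x ↦ v (T^[K] x) := hv.continuous.comp (hT.continuous.iterate K)
    have hc3 : Continuous fun x ↦ birkhoffAverage ℝ T (fun x ↦ u x - β * ψ x) K x - v (T^[K] x) :=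
      hc1.sub hc2
    simp only [hg]
    rw [integral_add (integrable_of_continuous hc3)
      (integrable_of_continuous hv.continuous), integral_sub (integrable_of_continuous hc1)
      (integrable_of_continuous hc2), integral_comp_iterate hν hv.continuous,
      integral_birkhoffAverage hν hT.continuous hlip.continuous hK]
    ring
  have hclosed : IsClosed {x | g x = 0} := isClosed_eq hglip'.continuous continuous_const
  -- A nonnegative continuous function with zero integral vanishes on the support of the measure.
  have hZ : minimizingSet T u ψ ⊆ {x | g x = 0} := by
    refine closure_minimal (iUnion₂_subset fun ν hν ↦ ?_) hclosed
    have := hν.1.1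
    refine Measure.support_subset_of_isClosed hclosed ?_
    have h1 : ∫ x, g x ∂ν = 0 := (hgint ν hν.1).trans (hminzero ν hν)
    rw [integral_eq_zero_iff_of_nonneg hgnn (integrable_of_continuous hglip'.continuous)] at h1
    exact h1
  -- Needed because `Metric.infDist` to the empty set is 0 by convention.
  have hZne : (minimizingSet T u ψ).Nonempty := by
    have := hν₀.1.1
    obtain ⟨z, hz⟩ := Measure.nonempty_support (μ := ν₀) (IsProbabilityMeasure.ne_zero ν₀)
    exact ⟨z, subset_closure (mem_iUnion₂.2 ⟨ν₀, hν₀, hz⟩)⟩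
  have hApos : (0 : ℝ) < (A₀ + 1 : ℝ≥0) := by positivity
  refine ⟨K, β, A₀ + 1, g, hK, by positivity, hglip', hgnn, hgint, fun x ↦ ?_⟩
  rw [← div_le_iff₀' hApos, Metric.le_infDist hZne]
  intro z hz
  rw [div_le_iff₀' hApos]
  have h1 := hglip'.dist_le_mul x z
  have h2 : g z = 0 := hZ hz
  rw [h2, dist_zero_right] at h1
  exact (le_abs_self _).trans h1

/-- Quantitative core: a penalty `w` that vanishes on `O` and is large away from `O` makes the
orbit measure of `O` the unique minimizing measure, stably under small perturbations `h`. -/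
theorem minimizingMeasures_eq_of_penalty {Λ : ℝ≥0} (hΛ : 1 ≤ Λ) (hT : LipschitzWith Λ T)
    {lam δ C L : ℝ} (hASP : IsASP T lam δ C L) {u ψ g : X → ℝ} (hu : Continuous u) {Lψ A : ℝ≥0}
    (hψ : LipschitzWith Lψ ψ) {m B : ℝ} (hm : 0 < m) (hψm : ∀ x, m ≤ ψ x) (hψB : ∀ x, ψ x ≤ B)
    {K : ℕ} (hK : 1 ≤ K) {β : ℝ} (hg : LipschitzWith A g) (hg0 : ∀ x, 0 ≤ g x)
    (hgint : ∀ ν ∈ invariantMeasures T, ∫ x, g x ∂ν = ∫ x, (u x - β * ψ x) ∂ν)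
    {O : Finset X} (hO : IsPeriodicOrbit T O) {D : ℝ} (hD : 0 < D) (hDδ : D ≤ δ)
    (hsep : ∀ p ∈ O, ∀ q ∈ O, p ≠ q → D ≤ dist p q) {t ρ θ g₁ g₂ : ℝ} (ht : 0 < t)
    (hdev : ∑ x ∈ O, g x ≤ t * D) {w h : X → ℝ} (hw : LipschitzWith 1 w) (hh : LipschitzWith 5 h)
    (hw0 : ∀ x, 0 ≤ w x) (hwO : ∀ x ∈ O, w x = 0)
    (hw₁ : ∀ y, (∀ p ∈ O, ρ * D ≤ dist y p) → K * (g₁ * D) ≤ w y)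
    (hw₂ : ∀ y, (∀ p ∈ O, θ * D ≤ dist y p) → K * (g₂ * D) ≤ w y)
    (hhle : ∀ x, |h x| ≤ t * D / O.card) (hρ : (Λ + 1) * ρ ≤ 1) (hθ : 0 < θ)
    (hθρ : θ ≤ ρ) (htδ : 2 * t / m * δ ≤ 1) (hg₁ : 0 < g₁)
    (ht₁ : t + 2 * t / m * B ≤ g₁ / 4) (ht₂ : t + 2 * t / m * B ≤ g₂)
    (hθ₁ : ((A + (6 + Lψ) * Λ ^ K : ℝ≥0) : ℝ) * (shadowConst lam C * θ) ≤ g₁ / 4) :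
    minimizingMeasures T (fun x ↦ u x + w x + h x) ψ = {orbitMeasure O} := by
  have hK0 : (0 : ℝ) < K := by exact_mod_cast hK
  have hc1 : (1 : ℝ) ≤ O.card := by exact_mod_cast hO.nonempty.card_pos
  have hc0 : (0 : ℝ) < O.card := by linarith
  have hTc := hT.continuous
  have hψpos : ∀ x, 0 < ψ x := fun x ↦ hm.trans_le (hψm x)
  have hμ := orbitMeasure_mem_invariantMeasures hO hTc
  have hμprob := hμ.1
  have hucont : Continuous fun x ↦ u x - β * ψ x := hu.sub (continuous_const.mul hψ.continuous)
  have hpert : Continuous fun x ↦ u x + w x + h x := (hu.add hw.continuous).add hh.continuous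
  obtain ⟨p₀, hp₀⟩ := hO.nonempty
  have hB : 0 < B := hm.trans_le ((hψm p₀).trans (hψB p₀))
  set S := ∑ x ∈ O, ψ x with hS
  have hSm : O.card * m ≤ S := by
    have := Finset.sum_le_sum fun x (_ : x ∈ O) ↦ hψm x
    simpa using this
  have hS0 : 0 < S := (by positivity : 0 < O.card * m).trans_le hSm
  -- The ratio attained by the orbit measure, the candidate for the new minimum.
  set a : ℝ := (∑ x ∈ O, (u x + w x + h x)) / S with ha
  have hsumg : ∑ x ∈ O, g x = ∑ x ∈ O, (u x - β * ψ x) := by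
    have h1 := hgint _ hμ
    rw [integral_orbitMeasure hg.continuous, integral_orbitMeasure hucont] at h1
    exact mul_left_cancel₀ (by positivity) h1
  have hab : (a - β) * S = ∑ x ∈ O, g x + ∑ x ∈ O, h x := by
    rw [sub_mul, ha, div_mul_cancel₀ _ hS0.ne', hsumg, Finset.sum_sub_distrib,
      Finset.sum_add_distrib, Finset.sum_add_distrib, Finset.sum_eq_zero hwO, ← Finset.mul_sum]
    ring
  set b : ℝ := a - β with hb
  have hsumh : |∑ x ∈ O, h x| ≤ t * D := by
    refine (Finset.abs_sum_le_sum_abs _ _).trans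
      ((Finset.sum_le_sum fun x _ ↦ hhle x).trans (le_of_eq ?_))
    rw [Finset.sum_const, nsmul_eq_mul]
    field_simp
  have hbabs : |b| ≤ 2 * t / m * (D / O.card) := by
    have h1 : |b| * S ≤ 2 * (t * D) := by
      rw [← abs_of_pos hS0, ← abs_mul, hab]
      refine (abs_add_le _ _).trans ?_
      rw [abs_of_nonneg (Finset.sum_nonneg fun x _ ↦ hg0 x)]
      linarith
    have h2 : |b| * (O.card * m) ≤ 2 * (t * D) :=
      (mul_le_mul_of_nonneg_left hSm (abs_nonneg b)).trans h1
    rw [div_mul_div_comm, le_div_iff₀ (by positivity)]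
    linarith
  have hDc : D / O.card ≤ δ := (div_le_self hD.le hc1).trans hDδ
  have hb1 : |b| ≤ 1 :=
    hbabs.trans ((mul_le_mul_of_nonneg_left hDc (by positivity)).trans htδ)
  set f : X → ℝ := fun x ↦ w x + h x - b * ψ x with hf
  have hflip : LipschitzWith (6 + Lψ) f := by
    have h1 : LipschitzWith (‖b‖₊ * Lψ) fun x ↦ b * ψ x := (lipschitzWith_smul b).comp hψ
    refine ((hw.add hh).sub h1).weaken ?_
    have h2 : ‖b‖₊ * Lψ ≤ 1 * Lψ :=
      mul_le_mul_left (by rw [← NNReal.coe_le_coe]; simpa using hb1) _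
    rw [one_mul] at h2
    calc (1 : ℝ≥0) + 5 + ‖b‖₊ * Lψ ≤ 1 + 5 + Lψ := by gcongr
      _ = 6 + Lψ := by norm_num
  -- Averaging over `K` steps keeps integrals; since `w ≥ 0`, the average of `w` is still at least
  -- `w / K`, the source of the factors `K` in `hw₁` and `hw₂`.
  set F : X → ℝ := fun x ↦ g x + birkhoffAverage ℝ T f K x with hF
  have havlip := lipschitzWith_birkhoffAverage hΛ hT hflip hK
  have hFlip : LipschitzWith (A + (6 + Lψ) * Λ ^ K) F := hg.add havlip
  have hFint : ∀ ν ∈ invariantMeasures T,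
      ∫ x, F x ∂ν = ∫ x, (u x + w x + h x - a * ψ x) ∂ν := fun ν hν ↦ by
    have := hν.1
    simp only [hF]
    rw [integral_add (integrable_of_continuous hg.continuous)
      (integrable_of_continuous havlip.continuous), hgint ν hν,
      integral_birkhoffAverage hν hTc hflip.continuous hK,
      ← integral_add (integrable_of_continuous hucont)
        (integrable_of_continuous hflip.continuous)]
    refine integral_congr_ae (Eventually.of_forall fun x ↦ ?_)
    simp only [hf, hb]
    ring
  -- Bounds `|h|` plus `b * ψ`. The factor `1 / O.card` keeps the loss over a whole period, `O.card
  -- * η`, of order `t * D`.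
  set η : ℝ := (t + 2 * t / m * B) * (D / O.card) with hη
  have hη0 : 0 ≤ η := by positivity
  have hηD : η ≤ (t + 2 * t / m * B) * D :=
    mul_le_mul_of_nonneg_left (div_le_self hD.le hc1) (by positivity)
  have hflow : ∀ x, w x - η ≤ f x := fun x ↦ by
    have h1 := (abs_le.1 (hhle x)).1
    have h2 : b * ψ x ≤ 2 * t / m * (D / O.card) * B :=
      (mul_le_mul_of_nonneg_right (le_abs_self b) (hψpos x).le).trans
        (mul_le_mul hbabs (hψB x) (hψpos x).le (by positivity))
    have h3 : η = t * D / O.card + 2 * t / m * (D / O.card) * B := by rw [hη]; ring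
    simp only [hf]
    linarith
  have hFlow : ∀ x, (K : ℝ)⁻¹ * w x - η ≤ F x := fun x ↦ by
    have h1 : w x - K * η ≤ birkhoffSum T f K x := by
      have h2 : ∑ i ∈ Finset.range K, (w (T^[i] x) - η) ≤ birkhoffSum T f K x :=
        Finset.sum_le_sum fun i _ ↦ hflow _
      rw [Finset.sum_sub_distrib, Finset.sum_const, Finset.card_range, nsmul_eq_mul] at h2
      have h3 : w (T^[0] x) ≤ ∑ i ∈ Finset.range K, w (T^[i] x) :=
        Finset.single_le_sum (f := fun i ↦ w (T^[i] x)) (fun i _ ↦ hw0 _) (Finset.mem_range.2 hK)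
      simp only [iterate_zero, id] at h3
      linarith
    have h4 : (K : ℝ)⁻¹ * w x - η ≤ birkhoffAverage ℝ T f K x := by
      simp only [birkhoffAverage, smul_eq_mul]
      have := mul_le_mul_of_nonneg_left h1 (inv_nonneg.2 hK0.le)
      rwa [mul_sub, inv_mul_cancel_left₀ hK0.ne'] at this
    have := hg0 x
    simp only [hF]
    linarith
  have hFfar : ∀ y c, K * (c * D) ≤ w y → c * D - η ≤ F y := fun y c hy ↦ by
    refine le_trans ?_ (hFlow y)
    have := mul_le_mul_of_nonneg_left hy (inv_nonneg.2 hK0.le)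
    rw [inv_mul_cancel_left₀ hK0.ne'] at this
    linarith
  have hpen : IsPenalized T O F (A + (6 + Lψ) * Λ ^ K) η (θ * D) (ρ * D) (g₁ * D - η) := by
    refine ⟨hFlip, hη0, fun x hx ↦ ?_, ?_, fun y hy ↦ ?_, fun y hy ↦ hFfar y g₁ (hw₁ y hy)⟩
    · have := hFlow x
      rw [hwO x hx] at this
      linarith
    · have h1 := hFint _ hμ
      have hcont : Continuous fun x ↦ u x + w x + h x - a * ψ x :=
        hpert.sub (continuous_const.mul hψ.continuous)
      rw [integral_orbitMeasure hFlip.continuous, integral_orbitMeasure hcont] at h1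
      rw [mul_left_cancel₀ (by positivity) h1, Finset.sum_sub_distrib, ← Finset.mul_sum, ← hS, ha,
        div_mul_cancel₀ _ hS0.ne', sub_self]
    · have h1 := hFfar y g₂ (hw₂ y hy)
      have h2 : (t + 2 * t / m * B) * D ≤ g₂ * D := mul_le_mul_of_nonneg_right ht₂ hD.le
      linarith
  have hρ0 : 0 < ρ := hθ.trans_le hθρ
  have hΛr : (1 : ℝ) ≤ Λ := by exact_mod_cast hΛ
  have hρ2 : 2 * ρ ≤ 1 :=
    (mul_le_mul_of_nonneg_right (by linarith) hρ0.le).trans hρ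
  refine minimizingMeasures_eq_singleton hpert hψ.continuous hψpos hμ (a := a) ?_ fun ν hν ↦ ?_
  · rw [integral_orbitMeasure hpert, integral_orbitMeasure hψ.continuous, ha]
    change _ = _ * (_ * S)
    field_simp
  · rw [← hFint ν hν]
    -- In units of `g₁ * D`, the period loss, the shadowing loss and `κ` take at most a quarter
    -- each, while `η` takes at most the last quarter from the payment `g₁ * D - η`.
    refine hpen.integral_nonneg hν hASP hO hT hsep (by positivity)
      (mul_le_mul_of_nonneg_right hθρ hD.le) ?_ ?_ ?_ (κ := g₁ / 4 * D) (by positivity) ?_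
    · rw [← mul_assoc]
      exact mul_le_of_le_one_left hD.le hρ
    · rw [← mul_assoc]
      exact mul_le_of_le_one_left hD.le hρ2
    · exact (mul_le_of_le_one_left hD.le (by linarith)).trans hDδ
    · have h1 : O.card * η = (t + 2 * t / m * B) * D := by rw [hη]; field_simp
      have h2 := mul_le_mul_of_nonneg_right hθ₁ hD.le
      have h3 := mul_le_mul_of_nonneg_right ht₁ hD.le
      rw [h1]
      have h4 : ((A + (6 + Lψ) * Λ ^ K : ℝ≥0) : ℝ) * (shadowConst lam C * (θ * D)) =
          ((A + (6 + Lψ) * Λ ^ K : ℝ≥0) : ℝ) * (shadowConst lam C * θ) * D := by ring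
      rw [h4]
      linarith

end Subaction

/-! ### Extended-valued norms translated to pointwise bounds. -/

section Norms

theorem norm_mvfderiv_const_mul_add_le {E : Type*} [NormedAddCommGroup E] [NormedSpace ℝ E]
    {H : Type*} [TopologicalSpace H] {I : ModelWithCorners ℝ E H}
    {M : Type*} [MetricSpace M] [ChartedSpace H M]
    [Bundle.RiemannianBundle (fun x : M => TangentSpace I x)] {w₁ w₂ : M → ℝ} {x : M}
    (h₁ : MDifferentiableAt I 𝓘(ℝ, ℝ) w₁ x) (h₂ : MDifferentiableAt I 𝓘(ℝ, ℝ) w₂ x)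
    {b₁ b₂ c : ℝ} (hb₁ : ‖mvfderiv I w₁ x‖ ≤ b₁) (hb₂ : ‖mvfderiv I w₂ x‖ ≤ b₂) (hc : 0 ≤ c) :
    ‖mvfderiv I (fun y ↦ c * (w₁ y + w₂ y)) x‖ ≤ c * (b₁ + b₂) := by
  have hb₁0 := (ContinuousLinearMap.opNorm_nonneg _).trans hb₁
  have hb₂0 := (ContinuousLinearMap.opNorm_nonneg _).trans hb₂
  refine ContinuousLinearMap.opNorm_le_bound _ (by positivity) fun v ↦ ?_
  have h3 : mvfderiv I (fun y ↦ c * (w₁ y + w₂ y)) x =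
      mvfderiv I ((fun _ ↦ c) * (w₁ + w₂)) x := rfl
  have h4 : mvfderiv I (fun y ↦ c * (w₁ y + w₂ y)) x v =
      c * (mvfderiv I w₁ x v + mvfderiv I w₂ x v) := by
    rw [h3, mvfderiv_mul mdifferentiableAt_const (h₁.add h₂), mvfderiv_add h₁ h₂, mvfderiv_const]
    simp [mul_add]
  rw [h4, norm_mul, Real.norm_of_nonneg hc, mul_assoc, add_mul]
  refine mul_le_mul_of_nonneg_left ((norm_add_le _ _).trans (add_le_add ?_ ?_)) hc
  · exact (ContinuousLinearMap.le_opNorm _ _).trans (mul_le_mul_of_nonneg_right hb₁ (norm_nonneg _))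
  · exact (ContinuousLinearMap.le_opNorm _ _).trans (mul_le_mul_of_nonneg_right hb₂ (norm_nonneg _))

theorem abs_le_of_supNorm_lt {M : Type*} {g : M → ℝ} {a : ℝ}
    (h : supNorm g < ENNReal.ofReal a) (x : M) : |g x| ≤ a := by
  have h1 : ‖g x‖ₑ < ENNReal.ofReal a := (le_iSup (fun x ↦ ‖g x‖ₑ) x).trans_lt h
  rw [← ofReal_norm, ENNReal.ofReal_lt_ofReal_iff_of_nonneg (norm_nonneg _)] at h1
  exact h1.le

theorem supNorm_lt {M : Type*} {g : M → ℝ} {a b : ℝ} (h : ∀ x, |g x| ≤ a) (hab : a < b)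
    (hb : 0 < b) : supNorm g < ENNReal.ofReal b := by
  refine lt_of_le_of_lt (iSup_le fun x ↦ ?_) ((ENNReal.ofReal_lt_ofReal_iff hb).2 hab)
  rw [← ofReal_norm]
  exact ENNReal.ofReal_le_ofReal (h x)

variable {n : ℕ} {M : Type*} [MetricSpace M] [ChartedSpace (EuclideanSpace ℝ (Fin n)) M]
  [Bundle.RiemannianBundle (fun x : M => TangentSpace (𝓡 n) x)]

theorem derivSupNorm_le {g : M → ℝ} {a : ℝ} (h : ∀ x, ‖mvfderiv (𝓡 n) g x‖ ≤ a) :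
    derivSupNorm (n := n) g ≤ ENNReal.ofReal a := by
  refine iSup_le fun x ↦ ?_
  rw [← ofReal_norm]
  exact ENNReal.ofReal_le_ofReal (h x)

theorem lipschitzWith_of_derivSupNorm_le [IsRiemannianManifold (𝓡 n) M] {g : M → ℝ}
    (hg : ContMDiff (𝓡 n) 𝓘(ℝ, ℝ) 1 g) {a : ℝ} (h : derivSupNorm (n := n) g ≤ ENNReal.ofReal a)
    {C : ℝ≥0} (hC : a ≤ C) : LipschitzWith C g := by
  refine lipschitzWith_of_enorm_mvfderiv_le hg fun x ↦ ?_
  refine (le_iSup (fun x ↦ ‖mvfderiv (𝓡 n) g x‖ₑ) x).trans (h.trans ?_)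
  rw [← ENNReal.ofReal_coe_nnreal]
  exact ENNReal.ofReal_le_ofReal hC

end Norms

end ErgOpt

/-! ### Choice of constants and assembly. -/

theorem proposition3p6 {n : ℕ} {M : Type*} [MetricSpace M] [CompactSpace M]
    [ChartedSpace (EuclideanSpace ℝ (Fin n)) M] [IsManifold (𝓡 n) ∞ M]
    [Bundle.RiemannianBundle (fun x : M => TangentSpace (𝓡 n) x)]
    [IsContMDiffRiemannianBundle (𝓡 n) ∞ (EuclideanSpace ℝ (Fin n))
      (fun x : M => TangentSpace (𝓡 n) x)]
    [IsRiemannianManifold (𝓡 n) M]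
    [MeasurableSpace M] [BorelSpace M]
    (f : M → M) (hf : Continuous f)
    (X : Set M) (hX : IsCompact X)
    (T : X → X) (hT : ∀ x, (T x : M) = f x) (hTLip : ∃ K : ℝ≥0, LipschitzWith K T)
    (lam δ C L : ℝ) (hASP : ErgOpt.IsASP T lam δ C L) (hMCGBP : ErgOpt.IsMCGBP T)
    (u : M → ℝ) (hu : ContMDiff (𝓡 n) 𝓘(ℝ, ℝ) 1 u)
    (ψ : M → ℝ) (hψ : ∃ K : ℝ≥0, LipschitzWith K ψ) (hψpos : ∀ x, 0 < ψ x) :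
    ∃ δ₁' : ℝ, 0 < δ₁' ∧ ∀ ε : ℝ, 0 < ε → ε < 1 →
      ∃ L₁ δ₁ : ℝ, 0 < L₁ ∧ 0 < δ₁ ∧
        ∀ O : Finset X, ErgOpt.IsPeriodicOrbit T O →
          ErgOpt.gap δ O >
            L₁ * ErgOpt.deviation 1 (ErgOpt.minimizingSet T (fun x => u x) (fun x => ψ x)) O →
          ∃ w : M → ℝ, ContMDiff (𝓡 n) 𝓘(ℝ, ℝ) ∞ w ∧
            ErgOpt.supNorm w < ENNReal.ofReal (δ₁' * ε) ∧
            ErgOpt.derivSupNorm (n := n) w < ENNReal.ofReal (2 * ε) ∧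
            ∀ h : M → ℝ, ContMDiff (𝓡 n) 𝓘(ℝ, ℝ) 1 h →
              ErgOpt.derivSupNorm (n := n) h < ENNReal.ofReal (5 * ε) →
              ErgOpt.supNorm h < ENNReal.ofReal (ErgOpt.gap δ O / O.card * δ₁) →
              ErgOpt.minimizingMeasures T (fun x => u x + w x + h x) (fun x => ψ x) =
                {ErgOpt.orbitMeasure O} := by
  have hδ := hASP.δ_pos
  refine ⟨3 * δ, by positivity, fun ε hε hε1 ↦ ?_⟩
  -- A periodic orbit supplies an invariant measure for the normalization. `O₀` serves only for this
  -- and nonemptiness of `X`, so the constants do not depend on the later `O`.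
  by_cases hex : ∃ O : Finset X, ErgOpt.IsPeriodicOrbit T O
  swap
  · exact ⟨1, 1, one_pos, one_pos, fun O hO ↦ absurd ⟨O, hO⟩ hex⟩
  obtain ⟨O₀, hO₀⟩ := hex
  have hXc : CompactSpace X := isCompact_iff_compactSpace.1 hX
  have hM1 : IsManifold (𝓡 n) 1 M := IsManifold.of_le (n := ∞) (by simp)
  have hbundle : IsContinuousRiemannianBundle (EuclideanSpace ℝ (Fin n))
      (fun x : M => TangentSpace (𝓡 n) x) := by
    obtain ⟨b, hb, hb'⟩ := IsContMDiffRiemannianBundle.exists_contMDiff (IB := 𝓡 n) (n := ∞)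
      (F := EuclideanSpace ℝ (Fin n)) (E := fun x : M => TangentSpace (𝓡 n) x)
    exact ⟨b, hb.continuous, hb'⟩
  obtain ⟨Λ₀, hΛ₀⟩ := hTLip
  obtain ⟨Lψ, hLψ⟩ := hψ
  set Λ : ℝ≥0 := max 1 Λ₀
  have hΛ : 1 ≤ Λ := le_max_left _ _
  have hTΛ : LipschitzWith Λ T := hΛ₀.weaken (le_max_right _ _)
  obtain ⟨Lu, hLu⟩ := ErgOpt.exists_enorm_mvfderiv_le hu
  have huM : LipschitzWith Lu u := ErgOpt.lipschitzWith_of_enorm_mvfderiv_le hu hLu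
  have hval : ∀ {g : M → ℝ} {c : ℝ≥0}, LipschitzWith c g → LipschitzWith c fun x : X ↦ g x :=
    fun hg ↦ (hg.comp (LipschitzWith.subtype_val X)).weaken (by simp)
  have huX := hval huM
  have hψX := hval hLψ
  obtain ⟨K, β, A, g, hK, hA, hg, hg0, hgint, hgZ⟩ := ErgOpt.exists_normalization hΛ hTΛ hMCGBP
    ⟨_, ErgOpt.orbitMeasure_mem_invariantMeasures hO₀ hTΛ.continuous⟩ huX hψX fun x ↦ hψpos x
  obtain ⟨p₀, hp₀⟩ := hO₀.nonempty
  obtain ⟨x₁, -, hx₁⟩ := (isCompact_univ (X := X)).exists_isMinOn ⟨p₀, mem_univ _⟩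
    hψX.continuous.continuousOn
  obtain ⟨x₂, -, hx₂⟩ := (isCompact_univ (X := X)).exists_isMaxOn ⟨p₀, mem_univ _⟩
    hψX.continuous.continuousOn
  set m : ℝ := ψ x₁
  set B : ℝ := ψ x₂
  have hm : 0 < m := hψpos x₁
  have hB : 0 < B := hψpos x₂
  have hψm : ∀ x : X, m ≤ ψ x := fun x ↦ isMinOn_iff.1 hx₁ x (mem_univ x)
  have hψB : ∀ x : X, ψ x ≤ B := fun x ↦ isMaxOn_iff.1 hx₂ x (mem_univ x)
  have hK0 : (0 : ℝ) < K := by exact_mod_cast hK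
  have hA0 : (0 : ℝ) < A := by exact_mod_cast hA
  have hΛr : (1 : ℝ) ≤ Λ := by exact_mod_cast hΛ
  -- Small enough for orbits to follow `O`, and strictly below `1/2` because `Λ ≥ 1`, as disjoint
  -- bumps require.
  set ρ : ℝ := 1 / (Λ + 2) with hρ_def
  have hρ0 : 0 < ρ := by positivity
  have hρ : (Λ + 1) * ρ ≤ 1 := by
    rw [hρ_def, mul_one_div, div_le_one (by positivity)]
    linarith
  have hρ2 : ρ < 1 / 2 := by
    rw [hρ_def]
    exact one_div_lt_one_div_of_lt two_pos (by linarith)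
  obtain ⟨κ₁, hκ₁, hκ₁1, hpen₁⟩ := ErgOpt.exists_smooth_penalty (I := 𝓡 n) (M := M) hρ0 hρ2
  -- Payment at scale `ρ`: weight `ε / 2` in `w`, divided by `K` for the Birkhoff average.
  set g₁ : ℝ := κ₁ * ε / (2 * K) with hg₁_def
  have hg₁ : 0 < g₁ := by positivity
  have hQ := ErgOpt.shadowConst_pos hASP.lam_pos hASP.C_pos
  set A' : ℝ := ((A + (6 + Lψ) * Λ ^ K : ℝ≥0) : ℝ)
  have hA' : 0 < A' := by positivity
  -- Makes the shadowing error at scale `θ` at most a quarter of the payment.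
  set θ : ℝ := min ρ (g₁ / 4 / (A' * ErgOpt.shadowConst lam C)) with hθ_def
  have hθ : 0 < θ := lt_min hρ0 (by positivity)
  have hθρ : θ ≤ ρ := min_le_left _ _
  have hθ₁ : A' * (ErgOpt.shadowConst lam C * θ) ≤ g₁ / 4 := by
    rw [← mul_assoc, mul_comm, ← le_div_iff₀ (by positivity)]
    exact min_le_right _ _
  obtain ⟨κ₂, hκ₂, hκ₂1, hpen₂⟩ := ErgOpt.exists_smooth_penalty (I := 𝓡 n) (M := M) hθ
    (hθρ.trans_lt hρ2)
  set g₂ : ℝ := κ₂ * ε / (2 * K) with hg₂_def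
  have hg₂ : 0 < g₂ := by positivity
  -- The first bound keeps the loss `t + 2tB/m` below both payments; the second keeps `|a - β| ≤ 1`,
  -- so the Lipschitz constant of `F` does not depend on `O`.
  set t : ℝ := min (min (g₁ / 4) g₂ / (1 + 2 * B / m)) (m / (2 * δ)) with ht_def
  have ht : 0 < t := lt_min (div_pos (lt_min (by positivity) hg₂) (by positivity)) (by positivity)
  have htδ : 2 * t / m * δ ≤ 1 := by
    have h1 : t ≤ m / (2 * δ) := min_le_right _ _
    rw [le_div_iff₀ (by positivity)] at h1
    rw [div_mul_eq_mul_div, div_le_one hm]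
    linarith
  have htB : t + 2 * t / m * B ≤ min (g₁ / 4) g₂ := by
    have h1 : t ≤ min (g₁ / 4) g₂ / (1 + 2 * B / m) := min_le_left _ _
    rw [le_div_iff₀ (by positivity)] at h1
    refine le_trans (le_of_eq ?_) h1
    ring
  -- `A / t` turns the gap hypothesis into `∑ g ≤ t * D`; `t` is the size allowed for `h`.
  refine ⟨A / t, t, by positivity, ht, fun O hO hgap ↦ ?_⟩
  set Z := ErgOpt.minimizingSet T (fun x => u x) (fun x => ψ x)
  set D : ℝ := ErgOpt.gap δ O with hD_def
  have hdev : ErgOpt.deviation 1 Z O = ∑ x ∈ O, Metric.infDist x Z := by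
    simp [ErgOpt.deviation]
  have hdev0 : 0 ≤ ErgOpt.deviation 1 Z O := by
    rw [hdev]
    exact Finset.sum_nonneg fun x _ ↦ Metric.infDist_nonneg
  have hD : 0 < D := lt_of_le_of_lt (by positivity) hgap
  have hDδ : D ≤ δ := ErgOpt.gap_le_delta hδ.le hO.nonempty
  have hsep : ∀ p ∈ O, ∀ q ∈ O, p ≠ q → D ≤ dist p q := fun p hp q hq hpq ↦
    ErgOpt.gap_le_dist hδ.le hp hq hpq
  have hsumg : ∑ x ∈ O, g x ≤ t * D := by
    have h1 : ∑ x ∈ O, g x ≤ A * ErgOpt.deviation 1 Z O := by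
      rw [hdev, Finset.mul_sum]
      exact Finset.sum_le_sum fun x _ ↦ hgZ x
    have h2 : A / t * ErgOpt.deviation 1 Z O < D := hgap
    rw [div_mul_eq_mul_div, div_lt_iff₀ ht] at h2
    linarith
  let O' : Finset M := O.map (Embedding.subtype _)
  have hO'mem : ∀ {p : X}, p ∈ O → (p : M) ∈ O' := fun hp ↦
    Finset.mem_map.2 ⟨_, hp, rfl⟩
  have hO'ex : ∀ q ∈ O', ∃ p : X, p ∈ O ∧ (p : M) = q := fun q hq ↦ by
    obtain ⟨p, hp, rfl⟩ := Finset.mem_map.1 hq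
    exact ⟨p, hp, rfl⟩
  have hsep' : ∀ p ∈ O', ∀ q ∈ O', p ≠ q → D ≤ dist p q := by
    intro p' hp' q' hq' hpq
    obtain ⟨p, hp, rfl⟩ := hO'ex p' hp'
    obtain ⟨q, hq, rfl⟩ := hO'ex q' hq'
    exact hsep p hp q hq fun h ↦ hpq (by rw [h])
  have hfar : ∀ {c : ℝ} {y : X}, (∀ p ∈ O, c ≤ dist y p) → ∀ q ∈ O', c ≤ dist (y : M) q := by
    intro c y hy q hq
    obtain ⟨p, hp, rfl⟩ := hO'ex q hq
    exact hy p hp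
  obtain ⟨w₁, hw₁s, hw₁b, hw₁O, hw₁far, hw₁d⟩ := hpen₁ D hD O' hsep'
  obtain ⟨w₂, hw₂s, hw₂b, hw₂O, hw₂far, hw₂d⟩ := hpen₂ D hD O' hsep'
  -- Each penalty has slope at most 1, so the sum has slope at most `ε`; its height is at most `δ *
  -- ε`.
  set w : M → ℝ := fun x ↦ ε / 2 * (w₁ x + w₂ x) with hw_def
  have hws : ContMDiff (𝓡 n) 𝓘(ℝ, ℝ) ∞ w := contMDiff_const.mul (hw₁s.add hw₂s)
  have hw0 : ∀ x, 0 ≤ w x := fun x ↦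
    mul_nonneg (by positivity) (add_nonneg (hw₁b x).1 (hw₂b x).1)
  have hwle : ∀ x, w x ≤ δ * ε := fun x ↦ by
    have h1 : w₁ x ≤ δ := (hw₁b x).2.trans ((mul_le_of_le_one_left hD.le hκ₁1).trans hDδ)
    have h2 : w₂ x ≤ δ := (hw₂b x).2.trans ((mul_le_of_le_one_left hD.le hκ₂1).trans hDδ)
    calc w x ≤ ε / 2 * (δ + δ) := mul_le_mul_of_nonneg_left (add_le_add h1 h2) (by positivity)
      _ = δ * ε := by ring
  have hwd : ErgOpt.derivSupNorm (n := n) w ≤ ENNReal.ofReal ε := by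
    refine ErgOpt.derivSupNorm_le fun x ↦ ?_
    refine (ErgOpt.norm_mvfderiv_const_mul_add_le (hw₁s.mdifferentiable (by simp) x)
      (hw₂s.mdifferentiable (by simp) x) (hw₁d x) (hw₂d x) (by positivity)).trans (le_of_eq ?_)
    ring
  have hδε : 0 < δ * ε := by positivity
  refine ⟨w, hws, ErgOpt.supNorm_lt (a := δ * ε) (fun x ↦ ?_) (by linarith) (by positivity),
    hwd.trans_lt ((ENNReal.ofReal_lt_ofReal_iff (by positivity)).2 (by linarith)),
    fun h hh hhd hhs ↦ ?_⟩
  · rw [abs_of_nonneg (hw0 x)]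
    exact hwle x
  have hwlip : LipschitzWith 1 w :=
    ErgOpt.lipschitzWith_of_derivSupNorm_le (hws.of_le (by simp)) hwd (by simpa using hε1.le)
  have hhlip : LipschitzWith 5 h :=
    ErgOpt.lipschitzWith_of_derivSupNorm_le hh hhd.le (by push_cast; linarith)
  refine ErgOpt.minimizingMeasures_eq_of_penalty hΛ hTΛ hASP huX.continuous hψX hm hψm hψB hK hg
    hg0 hgint hO hD hDδ hsep ht hsumg (g₁ := g₁) (g₂ := g₂) (hval hwlip) (hval hhlip)
    (fun x ↦ hw0 x) (fun x hx ↦ ?_) (fun y hy ↦ ?_) (fun y hy ↦ ?_) (fun x ↦ ?_) hρ hθ hθρ htδ hg₁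
    (htB.trans (min_le_left _ _)) (htB.trans (min_le_right _ _)) hθ₁
  · simp only [hw_def, hw₁O _ (hO'mem hx), hw₂O _ (hO'mem hx), add_zero, mul_zero]
  · have h1 := hw₁far y (hfar hy)
    have h2 := (hw₂b y).1
    have h3 : K * (g₁ * D) = ε / 2 * (κ₁ * D) := by rw [hg₁_def]; field_simp
    rw [h3, ← h1]
    exact mul_le_mul_of_nonneg_left (by linarith) (by positivity)
  · have h1 := hw₂far y (hfar hy)
    have h2 := (hw₁b y).1
    have h3 : K * (g₂ * D) = ε / 2 * (κ₂ * D) := by rw [hg₂_def]; field_simp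
    rw [h3, ← h1]
    exact mul_le_mul_of_nonneg_left (by linarith) (by positivity)
  · refine (ErgOpt.abs_le_of_supNorm_lt hhs x).trans (le_of_eq ?_)
    ring
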